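/- Let $(R,\mathfrak m,k)$ be a commutative Noetherian local ring, let $I\subseteq R$ be an ideal, and let $K(I)=K(x_1,\dots,x_r)$ be the Koszul complex on any finite generating set $x_1,\dots,x_r$ of $I$. For a complex $F$ of $R$-modules, the $R$-level $\mathrm{level}_R F$ is the least integer $n\ge 0$ such that $F$ is quasi-isomorphic (linked by a finite sequence of quasi-isomorphisms) to a direct summand of a complex $P$ that has a filtration by subcomplexes $$P=P(n)\supseteq P(n-1)\supseteq\cdots\supseteq P(0)=0$$ in which each of the $n$ subquotients $P(i)/P(i-1)$, $1\le i\le n$, is a bounded complex of finitely generated free $R$-modules with zero differential; $\mathrm{level}_R F=\infty$ if no such $n$ exists. The graded $k$-algebra $\mathrm{Tor}^R(R/I,k)=H(A\otimes_R k)$ is computed by any differential graded $R$-algebra resolution $A$ of $R/I$ (that is, an associative DG $R$-algebra $A$ in non-negative degrees with $A_0=R$, with each $A_n$ a projective $R$-module, with $H_0(A)=R/I$ and with $H_n(A)=0$ for $n\ge 1$; such a resolution always exists). Let $$\kappa^I\colon \bigwedge\nolimits_k \mathrm{Tor}^R_1(R/I,k)\longrightarrow \mathrm{Tor}^R(R/I,k)$$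 be the homomorphism of graded $k$-algebras that extends the inclusion of $\mathrm{Tor}^R_1(R/I,k)$, and let $\kappa^I_b\colon\bigwedge^b_k \mathrm{Tor}^R_1(R/I,k)\to\mathrm{Tor}^R_b(R/I,k)$ be its component of degree $b$. Then $$\mathrm{level}_R K(I)\ \ge\ \sup\{\,b\ge 0 \mid \kappa^I_b\neq 0\,\}+1,$$ where $\sup\varnothing=-\infty$ (the set is empty exactly when $I=R$). -/

import Mathlib

universe u

open CategoryTheory
open scoped TensorProduct

/-- Two complexes of `R`-modules are quasi-isomorphic, `X ≃ Y`, when they are linked by a finite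
sequence of quasi-isomorphisms (pointing in either direction). -/
def QuasiIsomorphic {R : Type u} [CommRing R] (X Y : ChainComplex (ModuleCat.{u} R) ℤ) : Prop :=
  Relation.EqvGen (fun X Y : ChainComplex (ModuleCat.{u} R) ℤ => ∃ f : X ⟶ Y, QuasiIso f) X Y

/-- A filtration of a complex `P` with `n` steps, `0 = P(0) ⊆ P(1) ⊆ ⋯ ⊆ P(n) = P`, by subcomplexes
such that each of the `n` subquotients `P(i+1)/P(i)` is a bounded complex of finitely generated
free modules with zero differential. The submodule `fil i j` of `P_j` is the degree `j` part of
`P(i)`. -/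
structure FreeFiltration {R : Type u} [CommRing R] (P : ChainComplex (ModuleCat.{u} R) ℤ)
    (n : ℕ) where
  fil : ℕ → ∀ j : ℤ, Submodule R (P.X j)
  fil_zero : ∀ j, fil 0 j = ⊥
  fil_last : ∀ j, fil n j = ⊤
  fil_mono : ∀ i < n, ∀ j, fil i j ≤ fil (i + 1) j
  /-- each `P(i)` is a subcomplex -/
  subcomplex : ∀ i ≤ n, ∀ j j' : ℤ, ∀ p ∈ fil i j, (P.d j j').hom p ∈ fil i j'
  /-- the differential of `P(i+1)/P(i)` is zero -/
  zero_differential : ∀ i < n, ∀ j j' : ℤ, ∀ p ∈ fil (i + 1) j, (P.d j j').hom p ∈ fil i j'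
  /-- the modules of `P(i+1)/P(i)` are free -/
  free : ∀ i < n, ∀ j, Module.Free R (fil (i + 1) j ⧸ (fil i j).submoduleOf (fil (i + 1) j))
  /-- the modules of `P(i+1)/P(i)` are finitely generated -/
  finite : ∀ i < n, ∀ j, Module.Finite R (fil (i + 1) j ⧸ (fil i j).submoduleOf (fil (i + 1) j))
  /-- the complex `P(i+1)/P(i)` is bounded -/
  bounded : ∀ i < n, ∃ a b : ℤ, ∀ j, j < a ∨ b < j → fil (i + 1) j = fil i j

/-- `F` is quasi-isomorphic to a direct summand (that is, a retract) of a complex with an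
`n`-step filtration as above. -/
def HasLevelLE {R : Type u} [CommRing R] (F : ChainComplex (ModuleCat.{u} R) ℤ) (n : ℕ) : Prop :=
  ∃ S P : ChainComplex (ModuleCat.{u} R) ℤ,
    QuasiIsomorphic F S ∧ Nonempty (Retract S P) ∧ Nonempty (FreeFiltration P n)

/-- The `R`-level of a complex: the least `n` such that `F` is quasi-isomorphic to a direct summand
of a complex with an `n`-step filtration as above, and `∞` if there is no such `n`. -/
noncomputable def rLevel {R : Type u} [CommRing R] (F : ChainComplex (ModuleCat.{u} R) ℤ) : ℕ∞ :=
  ⨅ n ∈ {n : ℕ | HasLevelLE F n}, (n : ℕ∞)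

namespace Koszul

/-- The linear form `e_i ↦ x_i` on `R^n`. -/
noncomputable def form {R : Type u} [CommRing R] {n : ℕ} (x : Fin n → R) :
    Module.Dual R (Fin n → R) :=
  Fintype.linearCombination R x

/-- The module of the Koszul complex in degree `j`: it is `⋀^j R^n` for `0 ≤ j`, and zero for
`j < 0`. -/
noncomputable def component (R : Type u) [CommRing R] (n : ℕ) :
    ℤ → Submodule R (ExteriorAlgebra R (Fin n → R))
  | Int.ofNat b => ⋀[R]^b (Fin n → R)
  | Int.negSucc _ => ⊥

/-- The Koszul differential on the exterior algebra: contraction with the linear form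
`e_i ↦ x_i`, that is,
`e_{i_1} ∧ ⋯ ∧ e_{i_b} ↦ ∑_j (-1)^(j-1) x_{i_j} e_{i_1} ∧ ⋯ ∧ (omit e_{i_j}) ∧ ⋯ ∧ e_{i_b}`. -/
noncomputable def diff {R : Type u} [CommRing R] {n : ℕ} (x : Fin n → R) :
    ExteriorAlgebra R (Fin n → R) →ₗ[R] ExteriorAlgebra R (Fin n → R) :=
  CliffordAlgebra.contractLeft (form x)

theorem diff_mem_exteriorPower {R : Type u} [CommRing R] {n : ℕ} (x : Fin n → R) (b : ℕ) :
    ∀ w ∈ ⋀[R]^(b + 1) (Fin n → R), diff x w ∈ ⋀[R]^b (Fin n → R) := by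
  induction b with
  | zero =>
    intro w hw
    rw [ExteriorAlgebra.exteriorPower, zero_add, pow_one] at hw
    obtain ⟨v, rfl⟩ := hw
    rw [ExteriorAlgebra.exteriorPower, pow_zero, diff]
    erw [CliffordAlgebra.contractLeft_ι]
    exact Submodule.algebraMap_mem _
  | succ b ih =>
    intro w hw
    rw [ExteriorAlgebra.exteriorPower, pow_succ'] at hw
    refine Submodule.mul_induction_on hw ?_ ?_
    · rintro _ ⟨v, rfl⟩ y hy
      rw [diff]
      erw [CliffordAlgebra.contractLeft_ι_mul]
      refine Submodule.sub_mem _ (Submodule.smul_mem _ _ hy) ?_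
      rw [ExteriorAlgebra.exteriorPower, pow_succ']
      exact Submodule.mul_mem_mul ⟨v, rfl⟩ (ih y hy)
    · intro a c ha hc
      rw [map_add]
      exact Submodule.add_mem _ ha hc

theorem diff_mem {R : Type u} [CommRing R] {n : ℕ} (x : Fin n → R) {i j : ℤ} (h : j + 1 = i) :
    ∀ w ∈ component R n i, diff x w ∈ component R n j := by
  subst h
  intro w hw
  match j with
  | Int.ofNat b => exact diff_mem_exteriorPower x b w hw
  | Int.negSucc 0 =>
    have hw' : w ∈ ⋀[R]^0 (Fin n → R) := hw
    rw [ExteriorAlgebra.exteriorPower, pow_zero] at hw'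
    obtain ⟨r, rfl⟩ := Submodule.mem_one.1 hw'
    rw [diff]
    erw [CliffordAlgebra.contractLeft_algebraMap]
    exact Submodule.zero_mem _
  | Int.negSucc (m + 1) =>
    have hw' : w = 0 := hw
    rw [hw', map_zero]
    exact Submodule.zero_mem _

end Koszul

open Classical in
/-- The Koszul complex `K(x_1, …, x_n)`. -/
noncomputable def koszulComplex {R : Type u} [CommRing R] {n : ℕ} (x : Fin n → R) :
    ChainComplex (ModuleCat.{u} R) ℤ where
  X j := ModuleCat.of R (Koszul.component R n j)
  d i j := if h : j + 1 = i then
      ModuleCat.ofHom ((Koszul.diff x).restrict (Koszul.diff_mem x h)) else 0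
  shape i j h := dif_neg h
  d_comp_d' i j k hij hjk := by
    have hij' : j + 1 = i := hij
    have hjk' : k + 1 = j := hjk
    rw [dif_pos hij', dif_pos hjk']
    ext w
    exact CliffordAlgebra.contractLeft_contractLeft (Koszul.form x) _

/-- A resolution of `R/I` by a differential graded `R`-algebra: a (strictly associative) DG algebra
`A`, concentrated in non-negative degrees, with `A_0 = R`, with every `A_n` a projective `R`-module,
with `H_0(A) = R/I`, and with `H_n(A) = 0` for `n ≥ 1`. So `A` is in particular a projective
resolution of the `R`-module `R/I`, and its multiplication `A ⊗ A → A` is a chain map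
that lifts the multiplication `R/I ⊗ R/I → R/I`. -/
structure DGAlgebraResolution (R : Type u) [CommRing R] (I : Ideal R) where
  /-- the underlying algebra, the sum of all `A_n` -/
  A : Type u
  [ring : Ring A]
  [algebra : Algebra R A]
  /-- `gr n` is the degree `n` part `A_n` -/
  gr : ℕ → Submodule R A
  [graded : GradedAlgebra gr]
  /-- the differential -/
  d : A →ₗ[R] A
  d_mem : ∀ n, ∀ a ∈ gr (n + 1), d a ∈ gr n
  d_zero : ∀ a ∈ gr 0, d a = 0
  d_d : ∀ a, d (d a) = 0
  leibniz : ∀ n, ∀ a ∈ gr n, ∀ b, d (a * b) = d a * b + (-1) ^ n * (a * d b)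
  projective : ∀ n, Module.Projective R (gr n)
  algebraMap_injective : Function.Injective (algebraMap R A)
  gr_zero : ∀ a ∈ gr 0, ∃ r, algebraMap R A r = a
  /-- the image of `A_1 → A_0 = R` is `I` -/
  range_d : ∀ r, (∃ a ∈ gr 1, d a = algebraMap R A r) ↔ r ∈ I
  /-- the complex is exact in positive degrees -/
  exact : ∀ n, 1 ≤ n → ∀ a ∈ gr n, d a = 0 → ∃ b ∈ gr (n + 1), d b = a

attribute [instance] DGAlgebraResolution.ring DGAlgebraResolution.algebra
  DGAlgebraResolution.graded

namespace DGAlgebraResolution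

theorem exists_sign {R : Type u} [CommRing R] {I : Ideal R} (A : DGAlgebraResolution R I) :
    ∃ σ : A.A →ₗ[R] A.A, (∀ a b, A.d (a * b) = A.d a * b + σ a * A.d b) ∧
      (∀ a, A.d (σ a) = - σ (A.d a)) ∧ (∀ a, σ (σ a) = a) := by
  let σ : A.A →ₗ[R] A.A :=
    (DirectSum.toModule R ℕ A.A fun n => ((-1 : R) ^ n) • (A.gr n).subtype) ∘ₗ
      (DirectSum.decomposeLinearEquiv A.gr).toLinearMap
  have hσ : ∀ n, ∀ a ∈ A.gr n, σ a = (-1 : R) ^ n • a := by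
    intro n a ha
    simp only [σ, LinearMap.comp_apply, LinearEquiv.coe_coe,
      DirectSum.decomposeLinearEquiv_apply]
    rw [DirectSum.decompose_of_mem _ ha]
    erw [DirectSum.toModule_lof]
    simp
  refine ⟨σ, fun a b => ?_, fun a => ?_, fun a => ?_⟩
  · refine DirectSum.Decomposition.inductionOn A.gr ?_ ?_ ?_ a
    · simp
    · intro n m
      rw [A.leibniz n m m.2, hσ n m m.2]
      simp only [smul_mul_assoc]
      rcases neg_one_pow_eq_or R n with h | h <;> rcases neg_one_pow_eq_or A.A n with h' | h'
      all_goals rcases Nat.even_or_odd n with e | e <;> simp [e.neg_one_pow]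
    · intro m m' h h'
      simp only [add_mul, map_add, h, h']
      abel
  · refine DirectSum.Decomposition.inductionOn A.gr ?_ ?_ ?_ a
    · simp
    · intro n m
      rw [hσ n m m.2]
      cases n with
      | zero => simp [A.d_zero m m.2]
      | succ n => rw [hσ n _ (A.d_mem n m m.2), map_smul, pow_succ]; simp
    · intro m m' h h'
      simp only [map_add, h, h']
      abel
  · refine DirectSum.Decomposition.inductionOn A.gr ?_ ?_ ?_ a
    · simp
    · intro n m
      rw [hσ n m m.2, map_smul, hσ n m m.2, smul_smul, ← mul_pow]
      simp
    · intro m m' h h'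
      simp only [map_add, h, h']

/-- The differential of `k ⊗ A`, where `k` is the residue field of `R`. -/
noncomputable def dk {R : Type u} [CommRing R] [IsLocalRing R] {I : Ideal R}
    (A : DGAlgebraResolution R I) :
    IsLocalRing.ResidueField R ⊗[R] A.A →ₗ[IsLocalRing.ResidueField R]
      IsLocalRing.ResidueField R ⊗[R] A.A :=
  A.d.baseChange (IsLocalRing.ResidueField R)

theorem exists_sign_dk {R : Type u} [CommRing R] [IsLocalRing R] {I : Ideal R}
    (A : DGAlgebraResolution R I) :
    ∃ σ : IsLocalRing.ResidueField R ⊗[R] A.A →ₗ[IsLocalRing.ResidueField R]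
        IsLocalRing.ResidueField R ⊗[R] A.A,
      (∀ a b, A.dk (a * b) = A.dk a * b + σ a * A.dk b) ∧
      (∀ a, A.dk (σ a) = - σ (A.dk a)) ∧ (∀ a, σ (σ a) = a) := by
  obtain ⟨σ, h1, h2, h3⟩ := A.exists_sign
  refine ⟨σ.baseChange _, fun a b => ?_, fun a => ?_, fun a => ?_⟩
  · induction a with
    | zero => simp
    | add a a' h h' => simp only [add_mul, map_add, h, h']; abel
    | tmul c a =>
      induction b with
      | zero => simp
      | add b b' h h' => simp only [mul_add, map_add, h, h']; abel
      | tmul e b =>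
        simp only [dk, Algebra.TensorProduct.tmul_mul_tmul, LinearMap.baseChange_tmul, h1,
          TensorProduct.tmul_add]
  · induction a with
    | zero => simp
    | add a a' h h' => simp only [map_add, h, h']; abel
    | tmul c a => simp only [dk, LinearMap.baseChange_tmul, h2, TensorProduct.tmul_neg]
  · induction a with
    | zero => simp
    | add a a' h h' => simp only [map_add, h, h']
    | tmul c a => simp only [LinearMap.baseChange_tmul, h3]

/-- The cycles of `k ⊗ A`, as a subalgebra. -/
noncomputable def cycles {R : Type u} [CommRing R] [IsLocalRing R] {I : Ideal R}
    (A : DGAlgebraResolution R I) :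
    Subalgebra (IsLocalRing.ResidueField R) (IsLocalRing.ResidueField R ⊗[R] A.A) where
  carrier := {z | A.dk z = 0}
  mul_mem' {a b} ha hb := by
    obtain ⟨σ, h1, -, -⟩ := A.exists_sign_dk
    simp only [Set.mem_ofPred_eq] at ha hb ⊢
    rw [h1, ha, hb, zero_mul, mul_zero, add_zero]
  add_mem' {a b} ha hb := by
    simp only [Set.mem_ofPred_eq] at ha hb ⊢
    rw [map_add, ha, hb, add_zero]
  algebraMap_mem' c := by
    have h : A.d 1 = 0 := A.d_zero 1 SetLike.GradedOne.one_mem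
    simp [dk, h]

/-- The boundaries of `k ⊗ A`, as an ideal of the algebra of cycles. -/
noncomputable def boundaries {R : Type u} [CommRing R] [IsLocalRing R] {I : Ideal R}
    (A : DGAlgebraResolution R I) : Ideal A.cycles where
  carrier := {z | ∃ c, A.dk c = z}
  zero_mem' := ⟨0, map_zero _⟩
  add_mem' := by
    rintro a b ⟨c, hc⟩ ⟨e, he⟩
    exact ⟨c + e, by simp [hc, he]⟩
  smul_mem' := by
    rintro ⟨z, hz⟩ b ⟨c, hc⟩
    obtain ⟨σ, h1, h2, h3⟩ := A.exists_sign_dk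
    have hz' : A.dk z = 0 := hz
    refine ⟨σ z * c, ?_⟩
    rw [h1, h2, h3, hz', hc]
    simp

instance boundaries_isTwoSided {R : Type u} [CommRing R] [IsLocalRing R] {I : Ideal R}
    (A : DGAlgebraResolution R I) : A.boundaries.IsTwoSided where
  mul_mem_of_left := by
    rintro b ⟨z, hz⟩ ⟨c, hc⟩
    obtain ⟨σ, h1, -, -⟩ := A.exists_sign_dk
    have hz' : A.dk z = 0 := hz
    refine ⟨c * z, ?_⟩
    rw [h1, hz', hc]
    simp

/-- `Tor^R(R/I, k) = H(A ⊗_R k)`, that is, cycles modulo boundaries. -/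
def Tor {R : Type u} [CommRing R] [IsLocalRing R] {I : Ideal R}
    (A : DGAlgebraResolution R I) : Type u :=
  A.cycles ⧸ A.boundaries

noncomputable instance {R : Type u} [CommRing R] [IsLocalRing R] {I : Ideal R}
    (A : DGAlgebraResolution R I) : Ring A.Tor :=
  inferInstanceAs (Ring (A.cycles ⧸ A.boundaries))

noncomputable instance {R : Type u} [CommRing R] [IsLocalRing R] {I : Ideal R}
    (A : DGAlgebraResolution R I) :
    Algebra (IsLocalRing.ResidueField R) A.Tor :=
  inferInstanceAs (Algebra (IsLocalRing.ResidueField R) (A.cycles ⧸ A.boundaries))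

/-- The homology class of a cycle of `k ⊗ A`. -/
noncomputable def toTor {R : Type u} [CommRing R] [IsLocalRing R] {I : Ideal R}
    (A : DGAlgebraResolution R I) :
    A.cycles →ₐ[IsLocalRing.ResidueField R] A.Tor :=
  Ideal.Quotient.mkₐ (IsLocalRing.ResidueField R) A.boundaries

theorem toTor_eq_zero {R : Type u} [CommRing R] [IsLocalRing R] {I : Ideal R}
    (A : DGAlgebraResolution R I) (z : A.cycles) :
    A.toTor z = 0 ↔ ∃ c, A.dk c = z :=
  Ideal.Quotient.eq_zero_iff_mem (I := A.boundaries)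

/-- The degree `n` part `Tor_n^R(R/I, k) = H_n(A ⊗_R k)` of `Tor^R(R/I, k)`: the classes of the
cycles that lie in `k ⊗ A_n`. -/
noncomputable def torDegree {R : Type u} [CommRing R] [IsLocalRing R] {I : Ideal R}
    (A : DGAlgebraResolution R I) (n : ℕ) : Submodule (IsLocalRing.ResidueField R) A.Tor :=
  (((A.gr n).baseChange (IsLocalRing.ResidueField R)).comap A.cycles.val.toLinearMap).map
    A.toTor.toLinearMap

theorem exists_of_mem_baseChange {R : Type u} [CommRing R] [IsLocalRing R] {I : Ideal R}
    (A : DGAlgebraResolution R I) (n : ℕ) (z : IsLocalRing.ResidueField R ⊗[R] A.A)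
    (hz : z ∈ (A.gr n).baseChange (IsLocalRing.ResidueField R)) :
    ∃ a ∈ A.gr n, z = 1 ⊗ₜ[R] a := by
  rw [Submodule.baseChange_eq_span] at hz
  induction hz using Submodule.span_induction with
  | mem z hz =>
    obtain ⟨a, ha, rfl⟩ := hz
    exact ⟨a, ha, rfl⟩
  | zero => exact ⟨0, zero_mem _, by simp⟩
  | add y z _ _ h h' =>
    obtain ⟨a, ha, rfl⟩ := h
    obtain ⟨b, hb, rfl⟩ := h'
    exact ⟨a + b, add_mem ha hb, by rw [TensorProduct.tmul_add]⟩
  | smul c z _ h =>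
    obtain ⟨a, ha, rfl⟩ := h
    obtain ⟨r, rfl⟩ := IsLocalRing.residue_surjective c
    refine ⟨r • a, Submodule.smul_mem _ _ ha, ?_⟩
    rw [TensorProduct.tmul_smul, ← IsLocalRing.ResidueField.algebraMap_eq, algebraMap_smul]

/-- Elements of `Tor_1` have square zero. -/
theorem mul_self_of_mem_torDegree_one {R : Type u} [CommRing R] [IsLocalRing R] {I : Ideal R}
    (A : DGAlgebraResolution R I) (t : A.Tor) (ht : t ∈ A.torDegree 1) : t * t = 0 := by
  obtain ⟨⟨z, hz⟩, hz1, rfl⟩ := ht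
  obtain ⟨a, ha, rfl⟩ := A.exists_of_mem_baseChange 1 z hz1
  obtain ⟨r, hr⟩ := A.gr_zero _ (A.d_mem 0 a ha)
  have h0 : A.d (a * a) = 0 := by
    rw [A.leibniz 1 a ha, ← hr, Algebra.commutes r a]
    simp
  obtain ⟨b, -, hb⟩ := A.exact 2 (by norm_num) (a * a) (SetLike.GradedMul.mul_mem ha ha) h0
  have h : A.toTor (⟨_, hz⟩ * ⟨_, hz⟩) = 0 := by
    refine (A.toTor_eq_zero _).2 ⟨1 ⊗ₜ b, ?_⟩
    simp [dk, hb]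
  rw [map_mul] at h
  exact h

/-- The product on `Tor` respects degrees. -/
theorem mul_mem_torDegree {R : Type u} [CommRing R] [IsLocalRing R] {I : Ideal R}
    (A : DGAlgebraResolution R I) (m n : ℕ) (s t : A.Tor)
    (hs : s ∈ A.torDegree m) (ht : t ∈ A.torDegree n) : s * t ∈ A.torDegree (m + n) := by
  obtain ⟨⟨p, hp⟩, hp1, rfl⟩ := hs
  obtain ⟨⟨q, hq⟩, hq1, rfl⟩ := ht
  obtain ⟨p, hpm, rfl⟩ := A.exists_of_mem_baseChange _ p hp1
  obtain ⟨q, hqm, rfl⟩ := A.exists_of_mem_baseChange _ q hq1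
  refine ⟨⟨_, hp⟩ * ⟨_, hq⟩, ?_, map_mul A.toTor _ _⟩
  change ((1 : IsLocalRing.ResidueField R) ⊗ₜ[R] p) * (1 ⊗ₜ[R] q) ∈
    (A.gr (m + n)).baseChange (IsLocalRing.ResidueField R)
  rw [Algebra.TensorProduct.tmul_mul_tmul]
  exact Submodule.tmul_mem_baseChange_of_mem _ (SetLike.GradedMul.mul_mem hpm hqm)

/-- The natural map of `k`-algebras `κ : ⋀ Tor_1(R/I, k) → Tor(R/I, k)`, that is, the one that
extends the inclusion of `Tor_1(R/I, k)`. -/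
noncomputable def kappa {R : Type u} [CommRing R] [IsLocalRing R] {I : Ideal R}
    (A : DGAlgebraResolution R I) :
    ExteriorAlgebra (IsLocalRing.ResidueField R) (A.torDegree 1)
      →ₐ[IsLocalRing.ResidueField R] A.Tor :=
  ExteriorAlgebra.lift (IsLocalRing.ResidueField R)
    ⟨(A.torDegree 1).subtype, fun t => A.mul_self_of_mem_torDegree_one t.1 t.2⟩

theorem kappa_mem {R : Type u} [CommRing R] [IsLocalRing R] {I : Ideal R}
    (A : DGAlgebraResolution R I) (b : ℕ) :
    ∀ w ∈ ⋀[IsLocalRing.ResidueField R]^b (A.torDegree 1), A.kappa w ∈ A.torDegree b := by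
  induction b with
  | zero =>
    intro w hw
    rw [ExteriorAlgebra.exteriorPower, pow_zero] at hw
    obtain ⟨c, rfl⟩ := Submodule.mem_one.1 hw
    refine ⟨algebraMap _ _ c, ?_, by simp⟩
    change c ⊗ₜ[R] (1 : A.A) ∈ (A.gr 0).baseChange (IsLocalRing.ResidueField R)
    exact Submodule.tmul_mem_baseChange_of_mem _ SetLike.GradedOne.one_mem
  | succ b ih =>
    intro w hw
    rw [ExteriorAlgebra.exteriorPower, pow_succ'] at hw
    refine Submodule.mul_induction_on hw ?_ ?_
    · rintro _ ⟨v, rfl⟩ y hy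
      have h1 : A.kappa (ExteriorAlgebra.ι _ v) = v.1 :=
        ExteriorAlgebra.lift_ι_apply _ _ _ v
      rw [map_mul, h1, add_comm]
      exact A.mul_mem_torDegree 1 b _ _ v.2 (ih y hy)
    · intro a c ha hc
      rw [map_add]
      exact Submodule.add_mem _ ha hc

/-- The degree `b` component `κ_b : ⋀^b Tor_1(R/I, k) → Tor_b(R/I, k)`. -/
noncomputable def kappaDegree {R : Type u} [CommRing R] [IsLocalRing R] {I : Ideal R}
    (A : DGAlgebraResolution R I) (b : ℕ) :
    ⋀[IsLocalRing.ResidueField R]^b (A.torDegree 1) →ₗ[IsLocalRing.ResidueField R]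
      A.torDegree b :=
  A.kappa.toLinearMap.restrict (A.kappa_mem b)

end DGAlgebraResolution

/-! Every ideal has a DG algebra resolution: it can be built on the free associative algebra on
enough generators, the generators of degree `n + 1` killing the cycles of degree `n`. -/

namespace FreeDGAlgebra

/-- Formal expressions, used to index enough generators. -/
inductive Term (R : Type u) : Type u
  | scalar : R → Term R
  | gen : ℕ → Term R → Term R
  | add : Term R → Term R → Term R
  | mul : Term R → Term R → Term R

/-- Words in the generators `(n, t)`; the generator `(n, t)` has degree `n + 1`. -/
abbrev Word (R : Type u) : Type u := FreeAddMonoid (ℕ × Term R)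

/-- The degree of a word. -/
def deg (R : Type u) : Word R →+ ℕ := FreeAddMonoid.lift fun g => g.1 + 1

/-- The free associative algebra on the generators. -/
abbrev Free (R : Type u) [CommRing R] : Type u := AddMonoidAlgebra R (Word R)

/-- A word as an element of the free algebra. -/
noncomputable def mon {R : Type u} [CommRing R] (w : Word R) : Free R := AddMonoidAlgebra.single w 1

theorem mon_add {R : Type u} [CommRing R] (w w' : Word R) : mon (w + w') = mon w * mon w' := by
  simp [mon, AddMonoidAlgebra.single_mul_single]

theorem mon_zero {R : Type u} [CommRing R] : mon (0 : Word R) = 1 := rfl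

/-- The element of the free algebra denoted by a formal expression. -/
noncomputable def interp {R : Type u} [CommRing R] : Term R → Free R
  | .scalar r => algebraMap R _ r
  | .gen n t => mon (FreeAddMonoid.of (n, t))
  | .add s t => interp s + interp t
  | .mul s t => interp s * interp t

theorem interp_mon {R : Type u} [CommRing R] (w : Word R) : ∃ t, interp t = mon w := by
  induction w using FreeAddMonoid.inductionOn' with
  | zero => exact ⟨.scalar 1, by rw [interp, map_one, mon_zero]⟩
  | of_add g w ih =>
    obtain ⟨t, ht⟩ := ih
    exact ⟨.mul (.gen g.1 g.2) t, by rw [interp, interp, ht, mon_add]⟩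

theorem interp_surjective {R : Type u} [CommRing R] (a : Free R) : ∃ t, interp t = a := by
  induction a using AddMonoidAlgebra.induction_on with
  | of w => exact interp_mon (Multiplicative.toAdd w)
  | add a b ha hb =>
    obtain ⟨s, rfl⟩ := ha
    obtain ⟨t, rfl⟩ := hb
    exact ⟨.add s t, rfl⟩
  | smul r a ha =>
    obtain ⟨s, rfl⟩ := ha
    exact ⟨.mul (.scalar r) s, by rw [interp, interp, Algebra.smul_def]⟩

/-- The grading of the free algebra. -/
abbrev gr (R : Type u) [CommRing R] : ℕ → Submodule R (Free R) :=
  AddMonoidAlgebra.gradeBy R (deg R)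

theorem gr_induction {R : Type u} [CommRing R] {n : ℕ} {p : Free R → Prop}
    (hw : ∀ w, deg R w = n → p (mon w)) (h0 : p 0) (hadd : ∀ a b, p a → p b → p (a + b))
    (hsmul : ∀ (r : R) a, p a → p (r • a)) : ∀ a ∈ gr R n, p a := by
  intro a ha
  rw [← AddMonoidAlgebra.sum_coeff_single a]
  refine Finset.sum_induction _ p hadd h0 fun w hws => ?_
  have h := hsmul (a.coeff w) _ (hw w (ha w hws))
  simpa [mon] using h

theorem mon_mem {R : Type u} [CommRing R] (w : Word R) : mon w ∈ gr R (deg R w) :=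
  AddMonoidAlgebra.single_mem_gradeBy _ _ _

/-- An algebra map into `2 × 2` matrices whose upper right entry is the skew derivation with
prescribed values on the generators. -/
noncomputable def phi {R : Type u} [CommRing R] (v : ℕ × Term R → Free R) :
    Free R →ₐ[R] Matrix (Fin 2) (Fin 2) (Free R) :=
  AddMonoidAlgebra.lift R _ _ (AddMonoidHom.toMultiplicativeLeft (FreeAddMonoid.lift fun g =>
    Additive.ofMul !![(-1) ^ (g.1 + 1) * mon (FreeAddMonoid.of g), v g;
      0, mon (FreeAddMonoid.of g)]))

theorem phi_of {R : Type u} [CommRing R] (v : ℕ × Term R → Free R) (g : ℕ × Term R) :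
    phi v (mon (FreeAddMonoid.of g)) = !![(-1) ^ (g.1 + 1) * mon (FreeAddMonoid.of g), v g;
      0, mon (FreeAddMonoid.of g)] := by
  simp [phi, mon]

/-- The skew derivation with prescribed values on the generators. -/
noncomputable def der {R : Type u} [CommRing R] (v : ℕ × Term R → Free R) : Free R →ₗ[R] Free R :=
  Matrix.entryLinearMap R (Free R) 0 1 ∘ₗ (phi v).toLinearMap

theorem der_apply {R : Type u} [CommRing R] (v : ℕ × Term R → Free R) (a : Free R) :
    der v a = phi v a 0 1 := rfl

theorem der_of {R : Type u} [CommRing R] (v : ℕ × Term R → Free R) (g : ℕ × Term R) :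
    der v (mon (FreeAddMonoid.of g)) = v g := by
  rw [der_apply, phi_of]; rfl

theorem der_algebraMap {R : Type u} [CommRing R] (v : ℕ × Term R → Free R) (r : R) :
    der v (algebraMap R _ r) = 0 := by
  rw [der_apply, AlgHom.commutes, Matrix.algebraMap_matrix_apply]
  simp

theorem der_one {R : Type u} [CommRing R] (v : ℕ × Term R → Free R) : der v 1 = 0 := by
  rw [← map_one (algebraMap R (Free R)), der_algebraMap]

theorem phi_mon {R : Type u} [CommRing R] (v : ℕ × Term R → Free R) (w : Word R) :
    phi v (mon w) = !![(-1) ^ (deg R w) * mon w, der v (mon w); 0, mon w] := by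
  induction w using FreeAddMonoid.inductionOn' with
  | zero =>
    have h : der v (mon 0) = 0 := der_one v
    rw [h, mon_zero, map_one, map_zero, pow_zero, one_mul, Matrix.one_fin_two]
  | of_add g w ih =>
    have hd : deg R (FreeAddMonoid.of g) = g.1 + 1 := by simp [deg]
    have hc : Commute (mon (FreeAddMonoid.of g)) ((-1 : Free R) ^ deg R w) :=
      (Commute.neg_one_right _).pow_right _
    rw [der_apply, mon_add, map_mul, phi_of, ih, Matrix.mul_fin_two, map_add, hd, pow_add]
    congr 1
    simp [mul_assoc, hc.left_comm, pow_add]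

theorem phi_mem {R : Type u} [CommRing R] (v : ℕ × Term R → Free R) (n : ℕ) :
    ∀ a ∈ gr R n, phi v a = !![(-1) ^ n * a, der v a; 0, a] := by
  refine gr_induction ?_ ?_ ?_ ?_
  · rintro w rfl
    exact phi_mon v w
  · ext i j; fin_cases i <;> fin_cases j <;> simp
  · intro a b ha hb
    rw [map_add, ha, hb]
    ext i j; fin_cases i <;> fin_cases j <;> simp [mul_add]
  · intro r a ha
    rw [map_smul, ha]
    ext i j; fin_cases i <;> fin_cases j <;> simp

theorem der_mul {R : Type u} [CommRing R] (v : ℕ × Term R → Free R) (n : ℕ) :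
    ∀ a ∈ gr R n, ∀ b, der v (a * b) = der v a * b + (-1) ^ n * (a * der v b) := by
  intro a ha b
  have h : ∀ b, phi v b 1 1 = b := by
    intro b
    refine DirectSum.Decomposition.inductionOn (gr R) ?_ ?_ ?_ b
    · simp
    · intro i m
      rw [phi_mem v i m m.2]; rfl
    · intro m m' h h'
      rw [map_add, Matrix.add_apply, h, h']
  rw [der_apply v (a * b), map_mul, Matrix.mul_apply, Fin.sum_univ_two, h, phi_mem v n a ha,
    ← der_apply v b]
  simp [mul_assoc, add_comm]

/-- The skew derivation lowers degrees by one if it does so on the generators. -/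
theorem der_mem {R : Type u} [CommRing R] (v : ℕ × Term R → Free R)
    (hv : ∀ g, v g ∈ gr R g.1) (n : ℕ) : ∀ a ∈ gr R (n + 1), der v a ∈ gr R n := by
  have key : ∀ w : Word R, ∀ m, deg R w = m + 1 → der v (mon w) ∈ gr R m := by
    intro w
    induction w using FreeAddMonoid.inductionOn' with
    | zero => intro m hm; simp at hm
    | of_add g w ih =>
      intro m hm
      have hd : deg R (FreeAddMonoid.of g) = g.1 + 1 := by simp [deg]
      rw [map_add, hd] at hm
      have hg := mon_mem (FreeAddMonoid.of g)
      rw [hd] at hg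
      rw [mon_add, der_mul v _ _ hg, der_of]
      refine add_mem ?_ ?_
      · have h := SetLike.GradedMul.mul_mem (A := gr R) (hv g) (mon_mem w)
        rwa [show g.1 + deg R w = m by omega] at h
      · have h : mon (FreeAddMonoid.of g) * der v (mon w) ∈ gr R m := by
          rcases Nat.eq_zero_or_pos (deg R w) with h0 | h0
          · have : der v (mon w) = 0 := by
              have h1 : w = 0 := by
                induction w using FreeAddMonoid.inductionOn' with
                | zero => rfl
                | of_add g' w' _ =>
                  rw [map_add] at h0
                  have : deg R (FreeAddMonoid.of g') = g'.1 + 1 := by simp [deg]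
                  omega
              rw [h1, mon_zero]
              exact der_one v
            rw [this, mul_zero]
            exact zero_mem _
          · have h := SetLike.GradedMul.mul_mem (A := gr R) hg
              (ih (deg R w - 1) (by omega))
            rwa [show g.1 + 1 + (deg R w - 1) = m by omega] at h
        rcases neg_one_pow_eq_or (Free R) (g.1 + 1) with e | e <;> rw [e]
        · rwa [one_mul]
        · rw [neg_one_mul]
          exact neg_mem h
  refine gr_induction (fun w hw => key w n hw) ?_ ?_ ?_
  · rw [map_zero]; exact zero_mem _
  · intro a b ha hb
    rw [map_add]; exact add_mem ha hb
  · intro r a ha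
    rw [map_smul]; exact Submodule.smul_mem _ _ ha

/-- In degree `n` only the generators of degree at most `n` matter. -/
theorem der_congr {R : Type u} [CommRing R] (v v' : ℕ × Term R → Free R) (n : ℕ)
    (h : ∀ g, g.1 < n → v g = v' g) : ∀ a ∈ gr R n, der v a = der v' a := by
  have key : ∀ w : Word R, deg R w ≤ n → der v (mon w) = der v' (mon w) := by
    intro w
    induction w using FreeAddMonoid.inductionOn' with
    | zero =>
      intro _
      rw [mon_zero, ← map_one (algebraMap R _), der_algebraMap, der_algebraMap]
    | of_add g w ih =>
      intro hw
      have hd : deg R (FreeAddMonoid.of g) = g.1 + 1 := by simp [deg]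
      rw [map_add, hd] at hw
      rw [mon_add, der_mul v _ _ (mon_mem _), der_mul v' _ _ (mon_mem _), der_of, der_of,
        ih (by omega), h g (by omega)]
  refine gr_induction (fun w hw => key w hw.le) ?_ ?_ ?_
  · simp
  · intro a b ha hb
    rw [map_add, map_add, ha, hb]
  · intro r a ha
    rw [map_smul, map_smul, ha]

theorem der_der {R : Type u} [CommRing R] (v : ℕ × Term R → Free R)
    (hv : ∀ g, v g ∈ gr R g.1) (hd : ∀ g, der v (v g) = 0) (a : Free R) :
    der v (der v a) = 0 := by
  have key : ∀ w : Word R, der v (der v (mon w)) = 0 := by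
    intro w
    induction w using FreeAddMonoid.inductionOn' with
    | zero => rw [mon_zero, ← map_one (algebraMap R _), der_algebraMap, map_zero]
    | of_add g w ih =>
      have hg := mon_mem (FreeAddMonoid.of g)
      rw [show deg R (FreeAddMonoid.of g) = g.1 + 1 by simp [deg]] at hg
      rw [mon_add, der_mul v _ _ hg, der_of, map_add, der_mul v _ _ (hv g), hd]
      rcases neg_one_pow_eq_or (Free R) g.1 with e | e <;> rw [pow_succ, e]
      · simp [der_mul v _ _ hg, der_of, ih, pow_succ, e]
      · simp [der_mul v _ _ hg, der_of, ih, pow_succ, e]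
  refine DirectSum.Decomposition.inductionOn (gr R) ?_ ?_ ?_ a
  · simp
  · intro i m
    refine gr_induction (n := i) (p := fun a => der v (der v a) = 0) (fun w _ => key w) ?_ ?_ ?_
      m m.2
    · simp
    · intro a b ha hb
      rw [map_add, map_add, ha, hb, add_zero]
    · intro r a ha
      rw [map_smul, map_smul, ha, smul_zero]
  · intro m m' h h'
    rw [map_add, map_add, h, h', add_zero]

open Classical in
/-- The value of the differential on the generator `(n, t)`: the element denoted by `t` if that is
a cycle of degree `n` (and an element of `I` for `n = 0`), and zero otherwise. -/
noncomputable def val {R : Type u} [CommRing R] (I : Ideal R) (n : ℕ) (t : Term R) : Free R :=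
  if interp t ∈ gr R n ∧ (n = 0 → ∃ r ∈ I, algebraMap R _ r = interp t) ∧
      der (fun g => if _h : g.1 < n then val I g.1 g.2 else 0) (interp t) = 0
    then interp t else 0
termination_by n

/-- The values of the differential on the generators. -/
noncomputable def gens {R : Type u} [CommRing R] (I : Ideal R) (g : ℕ × Term R) : Free R :=
  val I g.1 g.2

open Classical in
theorem gens_eq {R : Type u} [CommRing R] (I : Ideal R) (n : ℕ) (t : Term R) :
    gens I (n, t) = if interp t ∈ gr R n ∧ (n = 0 → ∃ r ∈ I, algebraMap R _ r = interp t) ∧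
      der (gens I) (interp t) = 0 then interp t else 0 := by
  rw [gens, val]
  refine if_congr (and_congr_right fun h => and_congr_right fun _ => ?_) rfl rfl
  rw [der_congr _ (gens I) n ?_ _ h]
  intro g hg
  simp [hg, gens]

theorem gens_mem {R : Type u} [CommRing R] (I : Ideal R) (g : ℕ × Term R) :
    gens I g ∈ gr R g.1 := by
  rw [show g = (g.1, g.2) from rfl, gens_eq]
  split_ifs with h
  · exact h.1
  · exact zero_mem _

theorem der_gens {R : Type u} [CommRing R] (I : Ideal R) (g : ℕ × Term R) :
    der (gens I) (gens I g) = 0 := by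
  rw [show g = (g.1, g.2) from rfl, gens_eq]
  split_ifs with h
  · exact h.2.2
  · exact map_zero _

theorem eq_algebraMap {R : Type u} [CommRing R] : ∀ a ∈ gr R 0, ∃ r, algebraMap R _ r = a := by
  refine gr_induction ?_ ⟨0, map_zero _⟩ ?_ ?_
  · intro w hw
    induction w using FreeAddMonoid.inductionOn' with
    | zero => exact ⟨1, map_one _⟩
    | of_add g w _ =>
      rw [map_add, show deg R (FreeAddMonoid.of g) = g.1 + 1 by simp [deg]] at hw
      omega
  · rintro _ _ ⟨r, rfl⟩ ⟨s, rfl⟩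
    exact ⟨r + s, map_add _ _ _⟩
  · rintro r _ ⟨s, rfl⟩
    exact ⟨r * s, by rw [map_mul, Algebra.smul_def]⟩

/-- The elements of degree one are mapped into `I`. -/
theorem der_degree_one {R : Type u} [CommRing R] (I : Ideal R) :
    ∀ a ∈ gr R 1, ∃ r ∈ I, algebraMap R _ r = der (gens I) a := by
  refine gr_induction ?_ ⟨0, zero_mem _, by simp⟩ ?_ ?_
  · intro w hw
    induction w using FreeAddMonoid.inductionOn' with
    | zero => simp at hw
    | of_add g w _ =>
      have hg : deg R (FreeAddMonoid.of g) = g.1 + 1 := by simp [deg]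
      rw [map_add, hg] at hw
      have hw0 : deg R w = 0 := by omega
      have hm := mon_mem w
      rw [hw0] at hm
      obtain ⟨s, hs⟩ := eq_algebraMap _ hm
      have h0 : g.1 = 0 := by omega
      obtain ⟨r, hr, hr'⟩ : ∃ r ∈ I, algebraMap R (Free R) r = gens I g := by
        rw [show g = (g.1, g.2) from rfl, gens_eq]
        split_ifs with h
        · exact h.2.1 h0
        · exact ⟨0, zero_mem _, map_zero _⟩
      refine ⟨r * s, I.mul_mem_right _ hr, ?_⟩
      rw [mon_add, der_mul _ _ _ (mon_mem _), der_of, ← hs, der_algebraMap, map_mul, hr']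
      simp
  · rintro a b ⟨r, hr, hr'⟩ ⟨s, hs, hs'⟩
    exact ⟨r + s, add_mem hr hs, by rw [map_add, map_add, hr', hs']⟩
  · rintro c a ⟨r, hr, hr'⟩
    exact ⟨c * r, I.mul_mem_left _ hr, by rw [map_mul, map_smul, hr', Algebra.smul_def]⟩

/-- Every cycle of degree `n` that is allowed to be a boundary is one. -/
theorem exists_der_eq {R : Type u} [CommRing R] (I : Ideal R) (n : ℕ) (a : Free R)
    (ha : a ∈ gr R n) (h0 : n = 0 → ∃ r ∈ I, algebraMap R _ r = a)
    (hd : der (gens I) a = 0) : ∃ b ∈ gr R (n + 1), der (gens I) b = a := by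
  obtain ⟨t, rfl⟩ := interp_surjective a
  refine ⟨mon (FreeAddMonoid.of (n, t)), ?_, ?_⟩
  · have h := mon_mem (FreeAddMonoid.of (n, t))
    rwa [show deg R (FreeAddMonoid.of (n, t)) = n + 1 by simp [deg]] at h
  · rw [der_of, gens_eq, if_pos ⟨ha, h0, hd⟩]

theorem projective_gr {R : Type u} [CommRing R] (n : ℕ) : Module.Projective R (gr R n) :=
  Module.Projective.of_split (gr R n).subtype
    (DirectSum.component R ℕ (fun i => gr R i) n ∘ₗ
      (DirectSum.decomposeLinearEquiv (gr R)).toLinearMap) (by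
      ext1 a
      simp only [LinearMap.comp_apply, LinearEquiv.coe_coe,
        DirectSum.decomposeLinearEquiv_apply, Submodule.subtype_apply,
        DirectSum.decompose_coe]
      exact DirectSum.component.lof_self (M := fun i => gr R i) R n a)

end FreeDGAlgebra

open FreeDGAlgebra in
/-- The quotient of a commutative ring by any ideal has a DG algebra resolution. -/
theorem DGAlgebraResolution.nonempty {R : Type u} [CommRing R] (I : Ideal R) :
    Nonempty (DGAlgebraResolution R I) :=
  ⟨{ A := Free R
     gr := FreeDGAlgebra.gr R
     d := der (gens I)
     d_mem := der_mem _ (gens_mem I)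
     d_zero := fun a ha => by
       obtain ⟨r, rfl⟩ := eq_algebraMap a ha
       exact der_algebraMap _ r
     d_d := der_der _ (gens_mem I) (der_gens I)
     leibniz := der_mul _
     projective := projective_gr
     algebraMap_injective := fun r s h => by
       simpa using congrArg (fun a : Free R => a.coeff 0) h
     gr_zero := eq_algebraMap
     range_d := fun r => by
       constructor
       · rintro ⟨a, ha, h⟩
         obtain ⟨s, hs, hs'⟩ := der_degree_one I a ha
         have h' : algebraMap R (Free R) s = algebraMap R (Free R) r := hs'.trans h
         have : s = r := by simpa using congrArg (fun a : Free R => a.coeff 0) h'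
         exact this ▸ hs
       · intro hr
         exact exists_der_eq I 0 _ (SetLike.algebraMap_mem_graded (FreeDGAlgebra.gr R) r) (fun _ => ⟨r, hr, rfl⟩)
           (der_algebraMap _ r)
     exact := fun n hn a ha h => exists_der_eq I n a ha (fun h0 => by omega) h }⟩

/-! Choose `a i` in `A_1` with differential `x i`. Sending `e_{i_1} ∧ ⋯ ∧ e_{i_b}`, `i_1 < ⋯ < i_b`,
to `a_{i_1} ⋯ a_{i_b}` gives a chain map `f : K(x) ⟶ A` (`koszulHom`). It is only linear: `A` need
not be graded commutative, so the `a i` need not satisfy the exterior relations. Since the classes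
of the `1 ⊗ a i` span `Tor_1`, the products of classes that span the image of `κ_b` are represented
by `1 ⊗ f(w)` with `w` of degree `b`.

Suppose that `K(x)` has level at most `N`, witnessed by a filtered complex `P`. Passing to the
derived category, `f` factors up to homotopy through some `β : P ⟶ A`
(`QuasiIsomorphic.exists_factorization`). As `A` is exact in positive degrees, each of the `N`
filtration steps costs one degree in the construction of a null-homotopy of `β`, which therefore
exists in degrees `≥ N` (`FreeFiltration.exists_homotopy`). So for `b ≥ N` and `w` of degree `b`,
`f(w)` is a boundary plus `t(∂w)` for a linear map `t`.

If `I` is proper, `∂w` has coefficients in the maximal ideal, so `t(∂w)` dies in `k ⊗ A` and `1 ⊗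
f(w)` is a boundary (`HasLevelLE.exists_dk_eq`). Hence `κ_b = 0` for all `b ≥ N`, which is the
bound. If `I = R`, then `Tor` itself is zero. -/

/-! ### Factoring maps up to homotopy through the derived category -/

section DerivedCategory

open DerivedCategory ChainComplex

variable {C : Type*} [Category* C] [Abelian C]

/-- The chain complex `K`, with the indexing reversed. -/
noncomputable abbrev ChainComplex.toCochain (C : Type*) [Category* C] [Abelian C] :
    ChainComplex C ℤ ⥤ CochainComplex C ℤ :=
  (cochainComplexEquivalence C).functor

theorem ChainComplex.quasiIso_toCochain {K L : ChainComplex C ℤ} (f : K ⟶ L) [QuasiIso f] :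
    QuasiIso ((toCochain C).map f) := by
  rw [quasiIso_iff]
  intro i
  rw [quasiIsoAt_iff' _ (i - 1) i (i + 1) (by simp) (by simp)]
  have h : QuasiIsoAt f (-i) := inferInstance
  rw [quasiIsoAt_iff' _ (-(i - 1)) (-i) (-(i + 1)) (by simp; omega) (by simp; omega)] at h
  -- Reversal is `i ↦ -i`, so the two short complexes agree definitionally.
  exact h

/-- Bounded below becomes bounded above after reversal, and bounded above complexes of projectives
are K-projective. -/
theorem ChainComplex.isKProjective_toCochain (K : ChainComplex C ℤ) (a : ℤ)
    (ha : ∀ j < a, Limits.IsZero (K.X j)) (hK : ∀ j, Projective (K.X j)) :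
    ((toCochain C).obj K).IsKProjective := by
  have : ∀ n : ℤ, Projective (((toCochain C).obj K).X n) := fun n => hK (-n)
  have : CochainComplex.IsStrictlyLE ((toCochain C).obj K) (-a) := by
    rw [CochainComplex.isStrictlyLE_iff]
    intro i hi
    exact ha (-i) (by omega)
  exact CochainComplex.isKProjective_of_projective _ (-a)

theorem QuasiIsomorphic.nonempty_iso {R : Type u} [CommRing R]
    [HasDerivedCategory (ModuleCat.{u} R)] {K S : ChainComplex (ModuleCat.{u} R) ℤ}
    (h : QuasiIsomorphic K S) :
    Nonempty (Q.obj ((toCochain _).obj K) ≅ Q.obj ((toCochain _).obj S)) := by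
  induction h with
  | rel K S h =>
    obtain ⟨f, hf⟩ := h
    have := quasiIso_toCochain f
    exact ⟨asIso (Q.map ((toCochain _).map f))⟩
  | refl K => exact ⟨Iso.refl _⟩
  | symm K S _ h => exact ⟨h.some.symm⟩
  | trans K L S _ _ h h' => exact ⟨h.some ≪≫ h'.some⟩

/-- Out of a K-projective complex, morphisms in the derived category are the same as homotopy
classes of chain maps. This is the surjective half; the next lemma is the injective half. -/
theorem CochainComplex.IsKProjective.exists_Q_map_eq [HasDerivedCategory C]
    {K L : CochainComplex C ℤ} [K.IsKProjective] (φ : Q.obj K ⟶ Q.obj L) :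
    ∃ f : K ⟶ L, Q.map f = φ := by
  obtain ⟨g, hg⟩ := (Qh_map_bijective K _).surjective
    ((quotientCompQhIso C).hom.app K ≫ φ ≫ (quotientCompQhIso C).inv.app L)
  obtain ⟨f, rfl⟩ := (HomotopyCategory.quotient _ _).map_surjective g
  refine ⟨f, ?_⟩
  rw [← cancel_epi ((quotientCompQhIso C).hom.app K),
    ← cancel_mono ((quotientCompQhIso C).inv.app L), ← quotientCompQhIso_hom_naturality]
  simpa using hg

theorem CochainComplex.IsKProjective.nonempty_homotopy [HasDerivedCategory C]
    {K L : CochainComplex C ℤ} [K.IsKProjective] {f g : K ⟶ L} (h : Q.map f = Q.map g) :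
    Nonempty (Homotopy f g) := by
  refine ⟨HomotopyCategory.homotopyOfEq _ _ ((Qh_map_bijective K _).injective ?_)⟩
  rw [← cancel_mono ((quotientCompQhIso C).hom.app L), quotientCompQhIso_hom_naturality,
    quotientCompQhIso_hom_naturality, h]

/-- In the derived category `K` is a retract of `P`, so `f` factors as `K → P → K → A`.
K-projectivity of `K` and of `P` lifts the maps `K → P` and `P → A` to chain maps, and that of `K`
turns the equality of composites into a homotopy. -/
theorem CochainComplex.exists_factorization_of_iso [HasDerivedCategory C]
    {K S P A : CochainComplex C ℤ} [K.IsKProjective] [P.IsKProjective]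
    (e : Q.obj K ≅ Q.obj S) (r : Retract S P) (f : K ⟶ A) :
    ∃ (α : K ⟶ P) (β : P ⟶ A), Nonempty (Homotopy f (α ≫ β)) := by
  obtain ⟨α, hα⟩ : ∃ α : K ⟶ P, Q.map α = e.hom ≫ Q.map r.i :=
    CochainComplex.IsKProjective.exists_Q_map_eq _
  obtain ⟨β, hβ⟩ : ∃ β : P ⟶ A, Q.map β = Q.map r.r ≫ e.inv ≫ Q.map f :=
    CochainComplex.IsKProjective.exists_Q_map_eq _
  refine ⟨α, β, CochainComplex.IsKProjective.nonempty_homotopy ?_⟩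
  rw [Functor.map_comp, hα, hβ, Category.assoc, ← Functor.map_comp_assoc Q r.i, r.retract]
  simp

/-- A map out of a complex `K` factors up to homotopy through any complex of which `K` is a
retract up to quasi-isomorphism, if both are bounded below complexes of projectives. -/
theorem QuasiIsomorphic.exists_factorization {R : Type u} [CommRing R]
    {K S P A : ChainComplex (ModuleCat.{u} R) ℤ} (h : QuasiIsomorphic K S) (r : Retract S P)
    (a b : ℤ) (hKa : ∀ j < a, Limits.IsZero (K.X j)) (hK : ∀ j, Projective (K.X j))
    (hPb : ∀ j < b, Limits.IsZero (P.X j)) (hP : ∀ j, Projective (P.X j)) (f : K ⟶ A) :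
    ∃ (α : K ⟶ P) (β : P ⟶ A), ∀ j, ∃ (s : K.X j ⟶ A.X (j + 1)) (t : K.X (j - 1) ⟶ A.X j),
      f.f j = (α ≫ β).f j + s ≫ A.d (j + 1) j + K.d j (j - 1) ≫ t := by
  let : HasDerivedCategory (ModuleCat.{u} R) := HasDerivedCategory.standard _
  have := isKProjective_toCochain K a hKa hK
  have := isKProjective_toCochain P b hPb hP
  obtain ⟨e⟩ := h.nonempty_iso
  obtain ⟨α, β, ⟨H⟩⟩ := CochainComplex.exists_factorization_of_iso e (r.map (toCochain _)) ((toCochain _).map f)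
  obtain ⟨α, rfl⟩ := (toCochain _).map_surjective α
  obtain ⟨β, rfl⟩ := (toCochain _).map_surjective β
  refine ⟨α, β, fun j => ?_⟩
  -- The neighbours of `j` are written as negatives of cochain degrees, so that the components of
  -- `H` have the required types definitionally.
  obtain ⟨i, rfl⟩ : ∃ i, j = -i := ⟨-j, by simp⟩
  obtain ⟨i₁, h₁⟩ : ∃ i₁, -i + 1 = -i₁ := ⟨i - 1, by omega⟩
  obtain ⟨i₀, h₀⟩ : ∃ i₀, -i - 1 = -i₀ := ⟨i + 1, by omega⟩
  rw [h₁, h₀]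
  refine ⟨H.hom i i₁, H.hom i₀ i, ?_⟩
  have h := H.comm i
  rw [dNext_eq _ (show (ComplexShape.up ℤ).Rel i i₀ by simp; omega),
    prevD_eq _ (show (ComplexShape.up ℤ).Rel i₁ i by simp; omega)] at h
  refine Eq.trans h ?_
  simp only [← Functor.map_comp]
  rw [add_comm, add_comm (_ ≫ _), ← add_assoc]
  rfl

end DerivedCategory

/-! ### Splitting off a submodule with projective quotient -/

section Splitting

variable {R M : Type*} [CommRing R] [AddCommGroup M] [Module R M]

/-- A section `s` of `N → N/N'` makes `p - s[p]` lie in `N'`, which defines `r`. -/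
theorem Submodule.exists_splitting_of_projective (N' N : Submodule R M)
    [Module.Projective R (N ⧸ N'.submoduleOf N)] :
    ∃ (s : (N ⧸ N'.submoduleOf N) →ₗ[R] N) (r : N →ₗ[R] N'),
      ∀ p, (r p : M) + s ((N'.submoduleOf N).mkQ p) = p := by
  obtain ⟨s, hs⟩ := Module.projective_lifting_property (N'.submoduleOf N).mkQ LinearMap.id
    (Submodule.mkQ_surjective _)
  refine ⟨s, (N.subtype ∘ₗ (LinearMap.id - s ∘ₗ (N'.submoduleOf N).mkQ)).codRestrict N' ?_, ?_⟩
  · intro p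
    have h : (N'.submoduleOf N).mkQ (p - s ((N'.submoduleOf N).mkQ p)) = 0 := by
      rw [map_sub, ← LinearMap.comp_apply _ s, hs, LinearMap.id_apply, sub_self]
    rw [Submodule.mkQ_apply, Submodule.Quotient.mk_eq_zero] at h
    exact h
  · intro p
    exact sub_add_cancel (p : M) _

theorem Submodule.exists_retraction_of_projective (N' N : Submodule R M)
    [Module.Projective R (N ⧸ N'.submoduleOf N)] :
    ∃ r : N →ₗ[R] N', ∀ p : N, (p : M) ∈ N' → (r p : M) = p := by
  obtain ⟨s, r, h⟩ := N'.exists_splitting_of_projective N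
  refine ⟨r, fun p hp => ?_⟩
  have h0 : (N'.submoduleOf N).mkQ p = 0 := by
    rw [Submodule.mkQ_apply, Submodule.Quotient.mk_eq_zero]
    exact hp
  simpa [h0] using h p

theorem Submodule.projective_of_projective_quotient (N' N : Submodule R M)
    (hN : N' ≤ N) [Module.Projective R (N ⧸ N'.submoduleOf N)] [Module.Projective R N'] :
    Module.Projective R N := by
  obtain ⟨s, r, h⟩ := N'.exists_splitting_of_projective N
  refine Module.Projective.of_split (r.prod (N'.submoduleOf N).mkQ)
    ((Submodule.inclusion hN).coprod s) ?_
  ext p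
  simpa using h p

end Splitting

/-! ### Null-homotopies along a free filtration -/

namespace FreeFiltration

variable {R : Type u} [CommRing R] {P : ChainComplex (ModuleCat.{u} R) ℤ} {n : ℕ}
  (F : FreeFiltration P n)
include F

theorem projective_fil (j : ℤ) (i : ℕ) (hi : i ≤ n) : Module.Projective R (F.fil i j) := by
  induction i with
  | zero => rw [F.fil_zero]; infer_instance
  | succ i ih =>
    have := ih (by omega)
    have := F.free i (by omega) j
    exact Submodule.projective_of_projective_quotient _ _ (F.fil_mono i (by omega) j)

theorem projective (j : ℤ) : Projective (P.X j) := by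
  have h := F.projective_fil j n le_rfl
  rw [F.fil_last] at h
  have : Module.Projective R (P.X j) := Module.Projective.of_equiv (Submodule.topEquiv)
  exact (IsProjective.iff_projective _).1 this

theorem exists_isZero : ∃ a : ℤ, ∀ j < a, Limits.IsZero (P.X j) := by
  have key : ∀ i ≤ n, ∃ a : ℤ, ∀ j < a, F.fil i j = ⊥ := by
    intro i hi
    induction i with
    | zero => exact ⟨0, fun j _ => F.fil_zero j⟩
    | succ i ih =>
      obtain ⟨a, ha⟩ := ih (by omega)
      obtain ⟨b, c, hb⟩ := F.bounded i (by omega)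
      exact ⟨min a b, fun j hj => by rw [hb j (Or.inl (by omega)), ha j (by omega)]⟩
  obtain ⟨a, ha⟩ := key n le_rfl
  refine ⟨a, fun j hj => ?_⟩
  have h := ha j hj
  rw [F.fil_last] at h
  have : Subsingleton (P.X j) := (Submodule.subsingleton_iff R).1 (subsingleton_of_bot_eq_top h.symm)
  exact ModuleCat.isZero_of_subsingleton _

/-- Composes the splittings of `P(i) ⊆ P(i+1) ⊆ ⋯ ⊆ P(n) = P`. It serves to extend maps defined on
`P(i)` to all of `P`. -/
theorem exists_retraction (j : ℤ) (i : ℕ) (hi : i ≤ n) :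
    ∃ r : P.X j →ₗ[R] F.fil i j, ∀ p ∈ F.fil i j, (r p : P.X j) = p := by
  induction hi using Nat.decreasingInduction with
  | self => exact ⟨LinearMap.id.codRestrict _ (by simp [F.fil_last]), fun p _ => rfl⟩
  | of_succ i hi ih =>
    obtain ⟨r, hr⟩ := ih
    have := F.free i hi j
    obtain ⟨r', hr'⟩ := Submodule.exists_retraction_of_projective (F.fil i j) (F.fil (i + 1) j)
    refine ⟨r' ∘ₗ r, fun p hp => ?_⟩
    have h := hr p (F.fil_mono i hi j hp)
    rw [LinearMap.comp_apply, hr' _ (by rwa [h]), h]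

/-- A linear map on `P(i+1)` that vanishes on `P(i)` and takes values in the range of `g` lifts
through `g` to a linear map on `P` that vanishes on `P(i)`. -/
theorem exists_lift {X Y : Type*} [AddCommGroup X] [Module R X] [AddCommGroup Y] [Module R Y]
    (j : ℤ) (i : ℕ) (hi : i < n) (g : X →ₗ[R] Y) (ψ : P.X j →ₗ[R] Y)
    (h0 : ∀ p ∈ F.fil i j, ψ p = 0) (hψ : ∀ p ∈ F.fil (i + 1) j, ∃ y, g y = ψ p) :
    ∃ k : P.X j →ₗ[R] X, (∀ p ∈ F.fil i j, k p = 0) ∧ ∀ p ∈ F.fil (i + 1) j, g (k p) = ψ p := by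
  have := F.free i hi j
  let N := F.fil (i + 1) j
  let ψ' : (N ⧸ (F.fil i j).submoduleOf N) →ₗ[R] LinearMap.range g :=
    Submodule.liftQ _ ((ψ ∘ₗ N.subtype).codRestrict (LinearMap.range g) fun p => hψ p p.2) (by
      intro p hp
      exact Subtype.ext (h0 _ hp))
  obtain ⟨s, hs⟩ := Module.projective_lifting_property g.rangeRestrict ψ' g.surjective_rangeRestrict
  obtain ⟨r, hr⟩ := F.exists_retraction j (i + 1) hi
  -- Factoring through the quotient `P(i+1)/P(i)` forces vanishing on `P(i)`; the retraction `r`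
  -- extends the map to `P`.
  refine ⟨s ∘ₗ ((F.fil i j).submoduleOf N).mkQ ∘ₗ r, fun p hp => ?_, fun p hp => ?_⟩
  · have h : ((F.fil i j).submoduleOf N).mkQ (r p) = 0 := by
      rw [Submodule.mkQ_apply, Submodule.Quotient.mk_eq_zero]
      change ((r p : N) : P.X j) ∈ F.fil i j
      rwa [hr p (F.fil_mono i hi j hp)]
    rw [LinearMap.comp_apply, LinearMap.comp_apply, h, map_zero]
  · have h := congrArg Subtype.val (LinearMap.congr_fun hs (((F.fil i j).submoduleOf N).mkQ (r p)))
    refine h.trans ?_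
    change ψ (r p : P.X j) = ψ p
    rw [hr p hp]

/-- A chain map from a complex with an `n`-step filtration to a complex that is exact in positive
degrees is homotopic to a map that vanishes in the degrees `≥ n`. -/
theorem exists_homotopy {A : ChainComplex (ModuleCat.{u} R) ℤ}
    (hA : ∀ j : ℤ, 1 ≤ j → ∀ z : A.X j, (A.d j (j - 1)).hom z = 0 →
      ∃ y, (A.d (j + 1) j).hom y = z) (φ : P ⟶ A) (i : ℕ) (hi : i ≤ n) :
    ∃ h : ∀ j j' : ℤ, P.X j →ₗ[R] A.X j', ∀ j : ℤ, i ≤ j → ∀ p ∈ F.fil i j,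
      (φ.f j).hom p = (A.d (j + 1) j).hom (h j (j + 1) p) +
        h (j - 1) j ((P.d j (j - 1)).hom p) := by
  induction i with
  | zero =>
    refine ⟨0, fun j _ p hp => ?_⟩
    rw [F.fil_zero, Submodule.mem_bot] at hp
    simp [hp]
  | succ i ih =>
    obtain ⟨h, hh⟩ := ih (by omega)
    -- The error left by the homotopy `h`: it vanishes on `P(i)` in degrees `≥ i` and commutes with
    -- the differentials.
    let ψ : ∀ j, P.X j →ₗ[R] A.X j := fun j => (φ.f j).hom - (A.d (j + 1) j).hom ∘ₗ h j (j + 1) -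
      h (j - 1) j ∘ₗ (P.d j (j - 1)).hom
    have hψ : ∀ j p, (φ.f j).hom p = ψ j p + ((A.d (j + 1) j).hom (h j (j + 1) p) +
        h (j - 1) j ((P.d j (j - 1)).hom p)) := by
      intro j p
      simp only [ψ, LinearMap.sub_apply, LinearMap.comp_apply]
      abel
    have hψ0 : ∀ j : ℤ, i ≤ j → ∀ p ∈ F.fil i j, ψ j p = 0 := by
      intro j hj p hp
      have h1 := hψ j p
      rw [hh j hj p hp] at h1
      simpa using h1
    have hψd : ∀ j p, (A.d j (j - 1)).hom (ψ j p) = ψ (j - 1) ((P.d j (j - 1)).hom p) := by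
      intro j p
      have hdA : (A.d j (j - 1)).hom ((A.d (j + 1) j).hom (h j (j + 1) p)) = 0 :=
        LinearMap.congr_fun (congrArg ModuleCat.Hom.hom (A.d_comp_d (j + 1) j (j - 1))) _
      have hdP : (P.d (j - 1) (j - 1 - 1)).hom ((P.d j (j - 1)).hom p) = 0 :=
        LinearMap.congr_fun (congrArg ModuleCat.Hom.hom (P.d_comp_d j (j - 1) (j - 1 - 1))) _
      have hφ : (A.d j (j - 1)).hom ((φ.f j).hom p) = (φ.f (j - 1)).hom ((P.d j (j - 1)).hom p) :=
        LinearMap.congr_fun (congrArg ModuleCat.Hom.hom (φ.comm j (j - 1))) p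
      -- Degrees `j - 1 + 1` and `j` are not definitionally equal; the two free indices of `h` let
      -- the transport be done by `rfl`.
      have hj : ∀ j', j' = j → (A.d j' (j - 1)).hom (h (j - 1) j' ((P.d j (j - 1)).hom p)) =
          (A.d j (j - 1)).hom (h (j - 1) j ((P.d j (j - 1)).hom p)) := by
        rintro _ rfl; rfl
      simp only [ψ, LinearMap.sub_apply, LinearMap.comp_apply, map_sub, hdA, hdP, hφ, map_zero,
        hj _ (sub_add_cancel j 1)]
      abel
    -- The correction in degree `j ≥ i + 1`. The differential maps `P(i+1)` into `P(i)`, where `ψ`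
    -- vanishes in degree `j - 1 ≥ i`, so `ψ` sends `P(i+1)` to cycles of degree `≥ 1`, which are
    -- boundaries. Other index pairs get zero.
    have hk : ∀ j j' : ℤ, ∃ k : P.X j →ₗ[R] A.X j', (∀ p ∈ F.fil i j, k p = 0) ∧
        (j' = j + 1 → ((i + 1 : ℕ) : ℤ) ≤ j → ∀ p ∈ F.fil (i + 1) j,
          (A.d j' j).hom (k p) = ψ j p) := by
      intro j j'
      by_cases hj : j' = j + 1 ∧ ((i + 1 : ℕ) : ℤ) ≤ j
      · obtain ⟨rfl, hj⟩ := hj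
        push_cast at hj
        obtain ⟨k, hk, hk'⟩ := F.exists_lift j i hi (A.d (j + 1) j).hom (ψ j)
          (hψ0 j (by omega)) (fun p hp => hA j (by omega) _ (by
            rw [hψd, hψ0 (j - 1) (by omega) _ (F.zero_differential i hi j _ p hp)]))
        exact ⟨k, hk, fun _ _ => hk'⟩
      · exact ⟨0, fun _ _ => rfl, fun h1 h2 => absurd ⟨h1, h2⟩ hj⟩
    choose k hk hk' using hk
    refine ⟨fun j j' => h j j' + k j j', fun j hj p hp => ?_⟩
    -- Since `k` vanishes on `P(i)`, the term `k ∘ d` contributes nothing on `P(i+1)`.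
    rw [hψ, ← hk' j (j + 1) rfl hj p hp, LinearMap.add_apply, LinearMap.add_apply,
      hk (j - 1) j _ (F.zero_differential i hi j _ p hp), map_add, add_zero]
    abel

end FreeFiltration

/-! ### Sorted wedge products, and the complex underlying a DG algebra -/

namespace ExteriorAlgebra

variable {R M : Type*} [CommRing R] [AddCommGroup M] [Module R M]

theorem ιMulti_family_eq_prod_sort {I : Type*} [LinearOrder I] (b : ℕ) (v : I → M)
    (s : Set.powersetCard I b) :
    ιMulti_family R b v s = (s.val.sort.map fun i => ι R (v i)).prod := by
  rw [ιMulti_family, ιMulti_apply, ← Finset.listMap_orderEmbOfFin_finRange s.val s.prop, List.map_map, List.ofFn_eq_map]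
  rfl

end ExteriorAlgebra

namespace DGAlgebraResolution

section Complex

variable {R : Type u} [CommRing R] {I : Ideal R} (A : DGAlgebraResolution R I)

/-- The degree `j` part `A_j`, which is zero for `j < 0`. -/
def component : ℤ → Submodule R A.A
  | Int.ofNat b => A.gr b
  | Int.negSucc _ => ⊥

theorem d_mem_component {i j : ℤ} (h : j + 1 = i) : ∀ a ∈ A.component i, A.d a ∈ A.component j := by
  subst h
  intro a ha
  match j with
  | Int.ofNat b => exact A.d_mem b a ha
  | Int.negSucc 0 => exact A.d_zero a ha
  | Int.negSucc (m + 1) =>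
    have ha' : a = 0 := ha
    rw [ha', map_zero]
    exact Submodule.zero_mem _

open Classical in
/-- The complex of `R`-modules that underlies a DG algebra resolution. -/
noncomputable def toChainComplex : ChainComplex (ModuleCat.{u} R) ℤ where
  X j := ModuleCat.of R (A.component j)
  d i j := if h : j + 1 = i then
      ModuleCat.ofHom (A.d.restrict (A.d_mem_component h)) else 0
  shape i j h := dif_neg h
  d_comp_d' i j k hij hjk := by
    have hij' : j + 1 = i := hij
    have hjk' : k + 1 = j := hjk
    rw [dif_pos hij', dif_pos hjk']
    ext w
    exact A.d_d _

theorem coe_toChainComplex_d {i j : ℤ} (h : j + 1 = i) (z : A.component i) :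
    (A.component j).subtype ((A.toChainComplex.d i j).hom z) = A.d z := by
  change (A.component j).subtype ((if h : j + 1 = i then
      ModuleCat.ofHom (A.d.restrict (A.d_mem_component h)) else 0 :
      ModuleCat.of R (A.component i) ⟶ ModuleCat.of R (A.component j)).hom z) = _
  rw [dif_pos h]
  rfl

theorem exists_toChainComplex_d_eq (j : ℤ) (hj : 1 ≤ j) (z : A.toChainComplex.X j)
    (hz : (A.toChainComplex.d j (j - 1)).hom z = 0) :
    ∃ y, (A.toChainComplex.d (j + 1) j).hom y = z := by
  obtain ⟨b, rfl⟩ : ∃ b : ℕ, j = b := ⟨j.toNat, by omega⟩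
  have hz' : A.d ((A.component b).subtype z) = 0 := by
    refine (A.coe_toChainComplex_d (sub_add_cancel (b : ℤ) 1) z).symm.trans ?_
    rw [hz]
    rfl
  obtain ⟨y, hy, hyz⟩ := A.exact b (by omega) _ (Subtype.property (p := (· ∈ A.component b)) z) hz'
  refine ⟨(⟨y, hy⟩ : A.component (b + 1 : ℕ)), ?_⟩
  exact Subtype.ext ((A.coe_toChainComplex_d rfl _).trans hyz)

theorem prod_map_mem_gr {ι : Type*} (a : ι → A.A) (ha : ∀ i, a i ∈ A.gr 1) (l : List ι) :
    (l.map a).prod ∈ A.gr l.length := by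
  induction l with
  | nil => exact SetLike.GradedOne.one_mem
  | cons i l ih =>
    rw [List.map_cons, List.prod_cons, List.length_cons, add_comm]
    exact SetLike.GradedMul.mul_mem (ha i) ih

end Complex

end DGAlgebraResolution

/-! ### The comparison map from the Koszul complex to the DG algebra -/

theorem coe_koszulComplex_d {R : Type u} [CommRing R] {n : ℕ} (x : Fin n → R) {i j : ℤ}
    (h : j + 1 = i) (z : Koszul.component R n i) :
    (Koszul.component R n j).subtype (((koszulComplex x).d i j).hom z) = Koszul.diff x z := by
  classical
  change (Koszul.component R n j).subtype ((if h : j + 1 = i then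
      ModuleCat.ofHom ((Koszul.diff x).restrict (Koszul.diff_mem x h)) else 0 :
      ModuleCat.of R (Koszul.component R n i) ⟶ ModuleCat.of R (Koszul.component R n j)).hom z) = _
  rw [dif_pos h]
  rfl

theorem koszulComplex_isZero {R : Type u} [CommRing R] {n : ℕ} (x : Fin n → R) :
    ∀ j < 0, Limits.IsZero ((koszulComplex x).X j) := by
  intro j hj
  match j, hj with
  | Int.negSucc m, _ =>
    have : Subsingleton ((koszulComplex x).X (Int.negSucc m)) :=
      inferInstanceAs (Subsingleton (⊥ : Submodule R (ExteriorAlgebra R (Fin n → R))))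
    exact ModuleCat.isZero_of_subsingleton _

theorem koszulComplex_projective {R : Type u} [CommRing R] {n : ℕ} (x : Fin n → R) (j : ℤ) :
    Projective ((koszulComplex x).X j) := by
  refine (IsProjective.iff_projective _).1 ?_
  match j with
  | Int.ofNat b =>
    exact Module.Projective.of_basis ((Pi.basisFun R (Fin n)).exteriorPower b)
  | Int.negSucc m =>
    exact inferInstanceAs (Module.Projective R (⊥ : Submodule R (ExteriorAlgebra R (Fin n → R))))

namespace Koszul

section Lift

variable {R B : Type*} [CommRing R] [Ring B] [Algebra R B] {n : ℕ}

/-- The product `e_{i_1} ∧ ⋯ ∧ e_{i_b}`. -/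
noncomputable def wedge (R : Type*) [CommRing R] {n : ℕ} (l : List (Fin n)) :
    ExteriorAlgebra R (Fin n → R) :=
  (l.map fun i => ExteriorAlgebra.ι R (Pi.basisFun R (Fin n) i)).prod

theorem wedge_cons (i : Fin n) (l : List (Fin n)) :
    wedge R (i :: l) = ExteriorAlgebra.ι R (Pi.basisFun R (Fin n) i) * wedge R l := by
  simp [wedge]

/-- The linear map `e_{i_1} ∧ ⋯ ∧ e_{i_b} ↦ a_{i_1} ⋯ a_{i_b}` for `i_1 < ⋯ < i_b`. -/
noncomputable def lift (R : Type*) [CommRing R] [Algebra R B] (a : Fin n → B) :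
    ExteriorAlgebra R (Fin n → R) →ₗ[R] B :=
  (Pi.basisFun R (Fin n)).ExteriorAlgebra.constr R fun s => (s.sort.map a).prod

theorem lift_wedge (a : Fin n → B) (l : List (Fin n)) (hl : l.Pairwise (· < ·)) :
    lift R a (wedge R l) = (l.map a).prod := by
  have hs : l.toFinset.sort = l :=
    (List.toFinset_sort _ (hl.imp ne_of_lt)).2 (hl.imp le_of_lt)
  have h : wedge R l = (Pi.basisFun R (Fin n)).ExteriorAlgebra l.toFinset := by
    rw [ExteriorAlgebra.basis_apply_ofCard _ rfl, ExteriorAlgebra.ιMulti_family_eq_prod_sort]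
    change _ = (l.toFinset.sort.map _).prod
    rw [hs, wedge]
  rw [h, lift, Module.Basis.constr_basis, hs]

/-- The span of the products of sublists of `l`. -/
noncomputable def sub (R : Type*) [CommRing R] {n : ℕ} (l : List (Fin n)) :
    Submodule R (ExteriorAlgebra R (Fin n → R)) :=
  Submodule.span R {w | ∃ l', l'.Sublist l ∧ wedge R l' = w}

theorem diff_wedge_cons (x : Fin n → R) (i : Fin n) (l : List (Fin n)) :
    diff x (wedge R (i :: l)) = x i • wedge R l -
      ExteriorAlgebra.ι R (Pi.basisFun R (Fin n) i) * diff x (wedge R l) := by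
  rw [wedge_cons, diff]
  refine (CliffordAlgebra.contractLeft_ι_mul _ _ _).trans ?_
  congr 2
  simp [form]

theorem diff_wedge_nil (x : Fin n → R) : diff x (wedge R []) = 0 :=
  CliffordAlgebra.contractLeft_one _ _

theorem ι_mul_mem_sub (i : Fin n) (l : List (Fin n)) :
    ∀ w ∈ sub R l, ExteriorAlgebra.ι R (Pi.basisFun R (Fin n) i) * w ∈ sub R (i :: l) := by
  intro w hw
  induction hw using Submodule.span_induction with
  | mem w hw =>
    obtain ⟨l', hl', rfl⟩ := hw
    exact Submodule.subset_span ⟨i :: l', hl'.cons_cons i, wedge_cons i l'⟩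
  | zero => rw [mul_zero]; exact zero_mem _
  | add w w' _ _ h h' => rw [mul_add]; exact add_mem h h'
  | smul r w _ h => rw [mul_smul_comm]; exact Submodule.smul_mem _ r h

/-- Contraction only deletes factors, so no reordering is ever needed. -/
theorem diff_wedge_mem_sub (x : Fin n → R) (l : List (Fin n)) :
    diff x (wedge R l) ∈ sub R l := by
  induction l with
  | nil => rw [diff_wedge_nil]; exact zero_mem _
  | cons i l ih =>
    rw [diff_wedge_cons]
    refine sub_mem (Submodule.smul_mem _ _ (Submodule.subset_span ⟨l, List.sublist_cons_self i l, rfl⟩))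
      (ι_mul_mem_sub i l _ ih)

/-- `lift` is not multiplicative in general, but here `i` precedes every entry of `l`, so prefixing
it to a sublist keeps the list increasing. -/
theorem lift_ι_mul (a : Fin n → B) (i : Fin n) (l : List (Fin n)) (hl : (i :: l).Pairwise (· < ·)) :
    ∀ w ∈ sub R l, lift R a (ExteriorAlgebra.ι R (Pi.basisFun R (Fin n) i) * w) =
      a i * lift R a w := by
  intro w hw
  induction hw using Submodule.span_induction with
  | mem w hw =>
    obtain ⟨l', hl', rfl⟩ := hw
    have h := hl.sublist (hl'.cons_cons i)
    rw [← wedge_cons, lift_wedge a _ h, lift_wedge a _ h.of_cons, List.map_cons, List.prod_cons]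
  | zero => simp
  | add w w' _ _ h h' => simp only [mul_add, map_add, h, h']
  | smul r w _ h => simp only [mul_smul_comm, map_smul, h]

theorem ext_wedge {N : Type*} [AddCommGroup N] [Module R N]
    {f g : ExteriorAlgebra R (Fin n → R) →ₗ[R] N}
    (h : ∀ l : List (Fin n), l.Pairwise (· < ·) → f (wedge R l) = g (wedge R l)) : f = g := by
  refine (Pi.basisFun R (Fin n)).ExteriorAlgebra.ext fun s => ?_
  rw [ExteriorAlgebra.basis_apply_ofCard _ rfl, ExteriorAlgebra.ιMulti_family_eq_prod_sort]
  exact h s.sort s.sortedLT_sort.pairwise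

theorem exteriorPower_eq_span_wedge (b : ℕ) : ⋀[R]^b (Fin n → R) =
    Submodule.span R {w | ∃ l : List (Fin n), l.Pairwise (· < ·) ∧ l.length = b ∧ wedge R l = w} := by
  rw [← exteriorPower.ιMulti_family_span_fixedDegree_of_span R (Pi.basisFun R (Fin n)).span_eq]
  refine le_antisymm (Submodule.span_le.2 ?_) (Submodule.span_le.2 ?_)
  · rintro _ ⟨s, rfl⟩
    refine Submodule.subset_span ⟨s.val.sort, s.val.sortedLT_sort.pairwise, ?_, ?_⟩
    · rw [Finset.length_sort]; exact s.prop
    · rw [ExteriorAlgebra.ιMulti_family_eq_prod_sort, wedge]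
  · rintro _ ⟨l, hl, rfl, rfl⟩
    have hs : l.toFinset.sort = l :=
      (List.toFinset_sort _ (hl.imp ne_of_lt)).2 (hl.imp le_of_lt)
    refine Submodule.subset_span ⟨⟨l.toFinset, List.toFinset_card_of_nodup (hl.imp ne_of_lt)⟩, ?_⟩
    rw [ExteriorAlgebra.ιMulti_family_eq_prod_sort, wedge]
    simp only [hs]

end Lift

variable {R : Type u} [CommRing R] {I : Ideal R} (A : DGAlgebraResolution R I) {n : ℕ}
  (x : Fin n → R) (a : Fin n → A.A) (ha : ∀ i, a i ∈ A.gr 1)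
  (hax : ∀ i, A.d (a i) = algebraMap R A.A (x i))

include ha in
theorem lift_mem_component (j : ℤ) : ∀ w ∈ component R n j, lift R a w ∈ A.component j := by
  intro w hw
  match j with
  | Int.ofNat b =>
    have hw' : w ∈ ⋀[R]^b (Fin n → R) := hw
    rw [exteriorPower_eq_span_wedge] at hw'
    refine (Submodule.span_le (p := (A.gr b).comap (lift R a))).2 ?_ hw'
    rintro _ ⟨l, hl, rfl, rfl⟩
    change lift R a (wedge R l) ∈ A.gr l.length
    rw [lift_wedge a l hl]
    exact A.prod_map_mem_gr a ha l
  | Int.negSucc _ =>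
    have hw' : w = 0 := hw
    rw [hw', map_zero]
    exact zero_mem _

include ha hax in
-- On increasing wedges, the Leibniz rule for `a i` times a product is the recursion satisfied by
-- the contraction.
theorem d_lift (w : ExteriorAlgebra R (Fin n → R)) :
    A.d (lift R a w) = lift R a (diff x w) := by
  suffices h : A.d ∘ₗ lift R a = lift R a ∘ₗ diff x from LinearMap.congr_fun h w
  refine ext_wedge fun l hl => ?_
  simp only [LinearMap.comp_apply]
  induction l with
  | nil =>
    rw [diff_wedge_nil, lift_wedge a _ hl, map_zero]
    exact A.d_zero 1 SetLike.GradedOne.one_mem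
  | cons i l ih =>
    rw [lift_wedge a _ hl, List.map_cons, List.prod_cons, A.leibniz 1 _ (ha i), hax,
      diff_wedge_cons, map_sub, map_smul, lift_ι_mul a i l hl _ (diff_wedge_mem_sub x l),
      ← ih hl.of_cons, lift_wedge a _ hl.of_cons, Algebra.smul_def]
    simp [sub_eq_add_neg]

end Koszul

/-- A morphism of complexes from the Koszul complex to a DG algebra resolution that sends each
`e_i` to `a_i`. -/
noncomputable def koszulHom {R : Type u} [CommRing R] {I : Ideal R} (A : DGAlgebraResolution R I)
    {n : ℕ} (x : Fin n → R) (a : Fin n → A.A) (ha : ∀ i, a i ∈ A.gr 1)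
    (hax : ∀ i, A.d (a i) = algebraMap R A.A (x i)) : koszulComplex x ⟶ A.toChainComplex where
  f j := ModuleCat.ofHom ((Koszul.lift R a).restrict (Koszul.lift_mem_component A a ha j))
  comm' i j hij := by
    have h : j + 1 = i := hij
    ext w
    refine Subtype.ext ?_
    refine (A.coe_toChainComplex_d h _).trans ?_
    refine (Koszul.d_lift A x a ha hax _).trans ?_
    exact congrArg (Koszul.lift R a) (coe_koszulComplex_d x h w).symm

/-! ### Minimality of the Koszul differential -/

namespace Koszul

variable {R : Type u} [CommRing R] {n : ℕ}

/-- The coefficients of the differential are the `x i`. Membership is in `J` times the exterior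
power, not merely `J` times the whole algebra, because it is fed to a linear map defined on that
degree alone. -/
theorem diff_mem_smul_exteriorPower (J : Ideal R) (x : Fin n → R) (hx : ∀ i, x i ∈ J) (b : ℕ) :
    ∀ w ∈ ⋀[R]^(b + 1) (Fin n → R), diff x w ∈ J • ⋀[R]^b (Fin n → R) := by
  intro w hw
  rw [exteriorPower_eq_span_wedge] at hw
  refine (Submodule.span_le (p := (J • ⋀[R]^b (Fin n → R)).comap (diff x))).2 ?_ hw
  clear w hw
  rintro _ ⟨l, -, hb, rfl⟩
  change diff x (wedge R l) ∈ J • ⋀[R]^b (Fin n → R)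
  induction l generalizing b with
  | nil => rw [diff_wedge_nil]; exact zero_mem _
  | cons i l ih =>
    have hl : l.length = b := by simpa using hb
    have hwedge : ∀ l : List (Fin n), wedge R l ∈ ⋀[R]^l.length (Fin n → R) := by
      intro l
      induction l with
      | nil =>
        rw [List.length_nil, ExteriorAlgebra.exteriorPower, pow_zero]
        exact Submodule.one_le.1 le_rfl
      | cons i l ih =>
        rw [wedge_cons, List.length_cons, ExteriorAlgebra.exteriorPower, pow_succ']
        exact Submodule.mul_mem_mul ⟨_, rfl⟩ ih
    rw [diff_wedge_cons]
    refine sub_mem (Submodule.smul_mem_smul (hx i) (hl ▸ hwedge l)) ?_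
    cases b with
    | zero =>
      rw [List.length_eq_zero_iff.1 hl, diff_wedge_nil, mul_zero]
      exact zero_mem _
    | succ b =>
      -- Left multiplication by `e_i` is linear, so it carries `J • ⋀^b` into `J • ⋀^(b+1)`.
      have h := Submodule.mem_map_of_mem
        (f := LinearMap.mulLeft R (ExteriorAlgebra.ι R (Pi.basisFun R (Fin n) i))) (ih b hl)
      rw [Submodule.map_smul''] at h
      refine Submodule.smul_mono le_rfl ?_ h
      rintro _ ⟨y, hy, rfl⟩
      rw [ExteriorAlgebra.exteriorPower, pow_succ']
      exact Submodule.mul_mem_mul ⟨_, rfl⟩ hy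

theorem diff_mem_smul (J : Ideal R) (x : Fin n → R) (hx : ∀ i, x i ∈ J) {i j : ℤ} (h : j + 1 = i) :
    ∀ w ∈ component R n i, diff x w ∈ J • component R n j := by
  intro w hw
  match j with
  | Int.ofNat b =>
    subst h
    exact diff_mem_smul_exteriorPower J x hx b w hw
  | Int.negSucc b =>
    have h0 : diff x w = 0 := diff_mem x h w hw
    rw [h0]
    exact zero_mem _

end Koszul

/-! ### Consequences of a level bound for the comparison map -/

section Level

variable {R : Type u} [CommRing R] {I : Ideal R} (A : DGAlgebraResolution R I) {n : ℕ}
  (x : Fin n → R) (a : Fin n → A.A) (ha : ∀ i, a i ∈ A.gr 1)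
  (hax : ∀ i, A.d (a i) = algebraMap R A.A (x i))
include ha hax

/-- If the level of the Koszul complex is at most `b`, then in degree `b` the comparison map to a
DG algebra resolution is homotopic to zero. -/
theorem HasLevelLE.exists_homotopy_koszul_lift {N : ℕ} (hN : HasLevelLE (koszulComplex x) N) (b : ℕ)
    (hb : N ≤ b) : ∃ t : Koszul.component R n (b - 1) →ₗ[R] A.A,
      ∀ w (hw : w ∈ Koszul.component R n b), ∃ u,
        Koszul.lift R a w = A.d u +
          t ⟨Koszul.diff x w, Koszul.diff_mem x (sub_add_cancel (b : ℤ) 1) w hw⟩ := by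
  obtain ⟨S, P, hS, ⟨r⟩, ⟨F⟩⟩ := hN
  obtain ⟨c, hc⟩ := F.exists_isZero
  obtain ⟨α, β, H⟩ := hS.exists_factorization r 0 c (koszulComplex_isZero x)
    (koszulComplex_projective x) hc F.projective (koszulHom A x a ha hax)
  obtain ⟨h, hh⟩ := F.exists_homotopy A.exists_toChainComplex_d_eq β N le_rfl
  obtain ⟨s, t, hst⟩ := H b
  -- The `∂`-side of the combined homotopy: `t` from the factorization through `P`, plus the
  -- null-homotopy `h` of `β` precomposed with `α`.
  refine ⟨(A.component b).subtype ∘ₗ (t.hom + h (b - 1) b ∘ₗ (α.f (b - 1)).hom), fun w hw => ?_⟩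
  let w' : (koszulComplex x).X b := (⟨w, hw⟩ : Koszul.component R n b)
  have hw' : ((koszulComplex x).d b (b - 1)).hom w' = (⟨Koszul.diff x w,
      Koszul.diff_mem x (sub_add_cancel (b : ℤ) 1) w hw⟩ : Koszul.component R n (b - 1)) :=
    Subtype.ext (coe_koszulComplex_d x (sub_add_cancel (b : ℤ) 1) _)
  have h1 := LinearMap.congr_fun (congrArg ModuleCat.Hom.hom hst) w'
  have h2 := hh b (by exact_mod_cast hb) ((α.f b).hom w') (by rw [F.fil_last]; trivial)
  have h3 : (P.d b (b - 1)).hom ((α.f b).hom w') =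
      (α.f (b - 1)).hom (((koszulComplex x).d b (b - 1)).hom w') :=
    LinearMap.congr_fun (congrArg ModuleCat.Hom.hom (α.comm b (b - 1))) w'
  have h4 : ((koszulHom A x a ha hax).f b).hom w' = (A.toChainComplex.d (b + 1) b).hom
      (s.hom w' + h b (b + 1) ((α.f b).hom w')) +
        (t.hom + h (b - 1) b ∘ₗ (α.f (b - 1)).hom) (((koszulComplex x).d b (b - 1)).hom w') := by
    refine h1.trans ?_
    change (β.f b).hom ((α.f b).hom w') + (A.toChainComplex.d (b + 1) b).hom (s.hom w') +
      t.hom (((koszulComplex x).d b (b - 1)).hom w') = _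
    rw [h2, h3, map_add, LinearMap.add_apply, LinearMap.comp_apply]
    abel
  refine ⟨(A.component (b + 1)).subtype (s.hom w' + h b (b + 1) ((α.f b).hom w')), ?_⟩
  have h5 := congrArg (A.component b).subtype h4
  refine h5.trans ?_
  rw [hw']
  exact (map_add (A.component b).subtype _ _).trans (congrArg (· + _) <|
    A.coe_toChainComplex_d rfl _)

/-- The term `t(∂w)` lies in the maximal ideal times the image of `t`, hence vanishes in `k ⊗ A`;
only the boundary survives. -/
theorem HasLevelLE.exists_dk_eq [IsLocalRing R] (hx : ∀ i, x i ∈ IsLocalRing.maximalIdeal R)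
    {N : ℕ} (hN : HasLevelLE (koszulComplex x) N) (b : ℕ) (hb : N ≤ b) :
    ∀ w ∈ ⋀[R]^b (Fin n → R), ∃ u, A.dk u = 1 ⊗ₜ[R] Koszul.lift R a w := by
  intro w hw
  obtain ⟨t, ht⟩ := hN.exists_homotopy_koszul_lift A x a ha hax b hb
  obtain ⟨u, hu⟩ := ht w hw
  refine ⟨1 ⊗ₜ u, ?_⟩
  let v : Koszul.component R n (b - 1) :=
    ⟨Koszul.diff x w, Koszul.diff_mem x (sub_add_cancel (b : ℤ) 1) w hw⟩
  have hv : v ∈ IsLocalRing.maximalIdeal R • (⊤ : Submodule R (Koszul.component R n (b - 1))) :=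
    (Submodule.mem_smul_top_iff _ _ v).2
      (Koszul.diff_mem_smul _ x hx (sub_add_cancel (b : ℤ) 1) w hw)
  have hle : IsLocalRing.maximalIdeal R • (⊤ : Submodule R (Koszul.component R n (b - 1))) ≤
      LinearMap.ker (TensorProduct.mk R (IsLocalRing.ResidueField R) A.A 1 ∘ₗ t) := by
    refine Submodule.smul_le.2 fun r hr y _ => ?_
    rw [LinearMap.mem_ker, map_smul]
    change r • ((1 : IsLocalRing.ResidueField R) ⊗ₜ[R] t y) = 0
    rw [TensorProduct.smul_tmul', Algebra.smul_def, IsLocalRing.ResidueField.algebraMap_eq,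
      (IsLocalRing.residue_eq_zero_iff r).2 hr, zero_mul, TensorProduct.zero_tmul]
  have h0 : (1 : IsLocalRing.ResidueField R) ⊗ₜ[R] t v = 0 := hle hv
  rw [hu, TensorProduct.tmul_add, h0, add_zero, DGAlgebraResolution.dk, LinearMap.baseChange_tmul]

end Level

/-! ### Vanishing of `κ` on the Tor algebra -/

namespace DGAlgebraResolution

section Tor

variable {R : Type u} [CommRing R] [IsLocalRing R] {I : Ideal R} (A : DGAlgebraResolution R I)

/-- The unit is a boundary. -/
theorem subsingleton_tor (hI : I = ⊤) : Subsingleton A.Tor := by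
  obtain ⟨a, -, ha⟩ := (A.range_d 1).2 (hI ▸ Submodule.mem_top)
  have h : A.toTor 1 = 0 := (A.toTor_eq_zero 1).2 ⟨1 ⊗ₜ a, by
    rw [dk, LinearMap.baseChange_tmul, ha, map_one]; rfl⟩
  rw [map_one] at h
  exact subsingleton_of_zero_eq_one h.symm

variable {n : ℕ} (x : Fin n → R) (hx : ∀ i, x i ∈ IsLocalRing.maximalIdeal R)
  (a : Fin n → A.A) (ha : ∀ i, a i ∈ A.gr 1) (hax : ∀ i, A.d (a i) = algebraMap R A.A (x i))

include hx hax in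
theorem dk_one_tmul_eq_zero (i : Fin n) : A.dk (1 ⊗ₜ[R] a i) = 0 := by
  rw [dk, LinearMap.baseChange_tmul, hax, Algebra.algebraMap_eq_smul_one, ← TensorProduct.smul_tmul,
    Algebra.smul_def, IsLocalRing.ResidueField.algebraMap_eq,
    (IsLocalRing.residue_eq_zero_iff _).2 (hx i), zero_mul, TensorProduct.zero_tmul]

/-- The class in `Tor_1` of an element of `A_1` whose differential is `x_i`. -/
noncomputable def torOne (i : Fin n) : A.torDegree 1 :=
  ⟨A.toTor ⟨1 ⊗ₜ a i, A.dk_one_tmul_eq_zero x hx a hax i⟩, ⟨_,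
    Submodule.tmul_mem_baseChange_of_mem _ (ha i), rfl⟩⟩

/-- If `c ∈ A_1` has `d c = ∑ f_i x_i`, then `c - ∑ f_i a_i` is a cycle of degree one, hence a
boundary, so the class of `1 ⊗ c` is the combination with coefficients the residues of the `f_i`. -/
theorem span_torOne (hI : Ideal.span (Set.range x) = I) :
    Submodule.span (IsLocalRing.ResidueField R) (Set.range (A.torOne x hx a ha hax)) = ⊤ := by
  rw [eq_top_iff]
  rintro ⟨_, ⟨z, hz⟩, hz1, rfl⟩ -
  obtain ⟨c, hc, rfl⟩ := A.exists_of_mem_baseChange 1 z hz1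
  obtain ⟨r, hr⟩ := A.gr_zero _ (A.d_mem 0 c hc)
  have hrI : r ∈ Ideal.span (Set.range x) := hI ▸ (A.range_d r).1 ⟨c, hc, hr.symm⟩
  obtain ⟨f, hf⟩ := Ideal.mem_span_range_iff_exists_fun.1 hrI
  have hd : A.d (c - ∑ i, f i • a i) = 0 := by
    rw [map_sub, ← hr, ← hf, map_sum, map_sum, sub_eq_zero]
    refine Finset.sum_congr rfl fun i _ => ?_
    rw [map_smul, hax, map_mul, Algebra.smul_def]
  obtain ⟨e, -, he⟩ := A.exact 1 le_rfl _
    (sub_mem hc (sum_mem fun i _ => Submodule.smul_mem _ (f i) (ha i))) hd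
  refine (Submodule.mem_span_range_iff_exists_fun _).2 ⟨fun i => IsLocalRing.residue R (f i), ?_⟩
  refine Subtype.ext ?_
  rw [eq_comm, ← sub_eq_zero, AddSubmonoidClass.coe_finsetSum]
  have h : ∀ i, ((IsLocalRing.residue R (f i) • A.torOne x hx a ha hax i : A.torDegree 1) : A.Tor) =
      A.toTor (IsLocalRing.residue R (f i) • ⟨1 ⊗ₜ a i, A.dk_one_tmul_eq_zero x hx a hax i⟩) :=
    fun i => (map_smul A.toTor _ _).symm
  simp only [h]
  change A.toTor _ - _ = 0
  rw [← map_sum, ← map_sub, A.toTor_eq_zero]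
  refine ⟨1 ⊗ₜ e, ?_⟩
  rw [dk, LinearMap.baseChange_tmul, he, TensorProduct.tmul_sub, TensorProduct.tmul_sum]
  simp only [AddSubgroupClass.coe_sub, AddSubmonoidClass.coe_finsetSum,
    ← IsLocalRing.ResidueField.algebraMap_eq, algebraMap_smul, TensorProduct.tmul_smul]
  rfl

include hx ha hax in
-- Increasing wedges of the spanning classes span `⋀^b Tor_1`, and `κ` sends such a wedge to the
-- class of `1 ⊗ lift w` for the corresponding increasing wedge `w`.
theorem kappaDegree_eq_zero_of_dk_eq (hI : Ideal.span (Set.range x) = I) (b : ℕ)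
    (h : ∀ w ∈ ⋀[R]^b (Fin n → R), ∃ u, A.dk u = 1 ⊗ₜ[R] Koszul.lift R a w) :
    A.kappaDegree b = 0 := by
  suffices hk : ⋀[IsLocalRing.ResidueField R]^b (A.torDegree 1) ≤ LinearMap.ker A.kappa.toLinearMap by
    exact LinearMap.ext fun w => Subtype.ext (hk w.2)
  rw [← exteriorPower.ιMulti_family_span_fixedDegree_of_span _ (A.span_torOne x hx a ha hax hI),
    Submodule.span_le]
  rintro _ ⟨s, rfl⟩
  rw [ExteriorAlgebra.ιMulti_family_eq_prod_sort]
  change A.kappa _ = 0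
  let z : Fin n → A.cycles := fun i => ⟨1 ⊗ₜ a i, A.dk_one_tmul_eq_zero x hx a hax i⟩
  have h1 : ∀ i, A.kappa (ExteriorAlgebra.ι _ (A.torOne x hx a ha hax i)) = A.toTor (z i) :=
    fun i => ExteriorAlgebra.lift_ι_apply _ _ _ _
  have h2 : ∀ l : List (Fin n), (((l.map z).prod : A.cycles) :
      IsLocalRing.ResidueField R ⊗[R] A.A) = 1 ⊗ₜ (l.map a).prod := by
    intro l
    induction l with
    | nil => rfl
    | cons i l ih =>
      rw [List.map_cons, List.prod_cons, List.map_cons, List.prod_cons, MulMemClass.coe_mul, ih,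
        Algebra.TensorProduct.tmul_mul_tmul, one_mul]
  have hl := s.val.sortedLT_sort.pairwise
  rw [map_list_prod, List.map_map, Function.comp_def]
  simp only [h1]
  rw [show (fun i => A.toTor (z i)) = A.toTor ∘ z from rfl, ← List.map_map, ← map_list_prod,
    A.toTor_eq_zero, h2, ← Koszul.lift_wedge (R := R) a _ hl]
  refine h _ ?_
  rw [Koszul.exteriorPower_eq_span_wedge]
  exact Submodule.subset_span ⟨_, hl, by rw [Finset.length_sort]; exact s.prop, rfl⟩

end Tor

/-- The unit ideal is treated apart, since the `x i` then need not lie in the maximal ideal. -/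
theorem kappaDegree_eq_zero {R : Type u} [CommRing R] [IsLocalRing R] {I : Ideal R}
    (A : DGAlgebraResolution R I) {n : ℕ} (x : Fin n → R) (hx : Ideal.span (Set.range x) = I)
    {N b : ℕ} (hN : HasLevelLE (koszulComplex x) N) (hb : N ≤ b) : A.kappaDegree b = 0 := by
  by_cases hI : I = ⊤
  · have := A.subsingleton_tor hI
    ext w
    exact Subsingleton.elim _ _
  · have hxI : ∀ i, x i ∈ I := fun i => hx ▸ Ideal.subset_span ⟨i, rfl⟩
    have hxm : ∀ i, x i ∈ IsLocalRing.maximalIdeal R :=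
      fun i => IsLocalRing.le_maximalIdeal hI (hxI i)
    choose a ha hax using fun i => (A.range_d (x i)).2 (hxI i)
    exact A.kappaDegree_eq_zero_of_dk_eq x hxm a ha hax hx b
      (hN.exists_dk_eq A x a ha hax hxm b hb)

end DGAlgebraResolution

/-- The supremum is taken in `{-∞} ∪ ℕ ∪ {∞}`, so that `sup ∅ = -∞`. -/
theorem lemma4p3 {R : Type u} [CommRing R] [IsNoetherianRing R] [IsLocalRing R] (I : Ideal R)
    (n : ℕ) (x : Fin n → R) (hx : Ideal.span (Set.range x) = I) (A : DGAlgebraResolution R I) :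
    (⨆ b ∈ {b : ℕ | A.kappaDegree b ≠ 0}, ((b : ℕ∞) : WithBot ℕ∞)) + 1 ≤
      ((rLevel (koszulComplex x) : ℕ∞) : WithBot ℕ∞) := by
  have key : ∀ b : ℕ, A.kappaDegree b ≠ 0 → ((b : ℕ∞) + 1) ≤ rLevel (koszulComplex x) := by
    intro b hb
    refine le_iInf₂ fun N hN => ?_
    have h : b < N := by
      by_contra h
      exact hb (A.kappaDegree_eq_zero x hx hN (by omega))
    exact_mod_cast h
  by_cases h : ∃ b, A.kappaDegree b ≠ 0
  -- Level at least one lets the level be written as `m + 1`, so that the `+ 1` cancels.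
  · have h1 : (1 : ℕ∞) ≤ rLevel (koszulComplex x) := by
      obtain ⟨b, hb⟩ := h
      exact le_trans le_add_self (key b hb)
    obtain ⟨m, hm⟩ := exists_add_of_le h1
    rw [hm, add_comm 1 m]
    push_cast
    gcongr
    refine iSup₂_le fun b hb => ?_
    have := key b hb
    rw [hm, add_comm 1 m] at this
    exact_mod_cast (ENat.add_le_add_iff_right ENat.one_ne_top).1 this
  -- The supremum is now `⊥`, and `⊥ + 1 = ⊥`.
  · push Not at h
    simp [h]
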